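/- **Theorem 4.2.** Let $(M,\omega)$ be a connected (finite-dimensional, smooth, Hausdorff, second countable) symplectic manifold. For $g\in C^\infty(M)=C^\infty(M,\mathbb C)$ let $X_g$ be defined by $i_{X_g}\omega=dg$ and let $\{f,g\}=df(X_g)$ be the Poisson bracket (extended $\mathbb C$-bilinearly). Let $*$ be a star product on $(M,\omega)$, i.e. an associative $\mathbb C[[\lambda]]$-bilinear product on $C^\infty(M)[[\lambda]]$ of the form $f*g=\sum_{r\ge 0}\lambda^r M_r(f,g)$ for $f,g\in C^\infty(M)$ (extended $\lambda$-adically to formal series), where the $M_r$ are bidifferential operators, $M_0(f,g)=fg$, $M_1(f,g)-M_1(g,f)=\mathrm i\{f,g\}$, and $M_r(1,f)=M_r(f,1)=0$ for $r\ge 1$. Let $X$ be a symplectic vector field, i.e. a smooth real vector field such that the $1$-form $\alpha:=i_X\omega$ is closed, and let $\delta_X$ be the map on $C^\infty(M)[[\lambda]]$ which, on every open set where $\alpha=dH$ with $H$ real and smooth, is given by $\delta_X F=H*F-F*H$. This is well defined and raises the degree in $\lambda$ by at least one, so that $e^{\beta\delta_X}=\sum_{r\ge0}\frac{1}{r!}(\beta\delta_X)^r$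 is well defined for $\beta\in\mathbb R$. Let $0\neq\beta\in\mathbb R$, let $C_0^\infty(M)[[\lambda]]$ be the formal power series whose coefficients are smooth complex functions with compact support, and let $\mu:C_0^\infty(M)[[\lambda]]\to\mathbb C[[\lambda]]$ be a $\mathbb C[[\lambda]]$-linear functional satisfying the static formal KMS condition for the inverse temperature $\beta$ with respect to $X$: $$\mu(F*G)=\mu\bigl(G*e^{\beta\delta_X}(F)\bigr)\qquad\text{for all }F,G\in C_0^\infty(M)[[\lambda]].$$ Then $\mu=0$, or $\alpha=i_X\omega$ is exact, i.e. there is a smooth real function $H$ on $M$ with $i_X\omega=dH$. -/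

import Mathlib

open scoped Manifold ContDiff Topology

noncomputable section

/-! ## Differential forms on manifolds, symplectic forms -/

theorem update_pair_zero {V : Type*} (a b c : V) : Function.update ![a, b] 0 c = ![c, b] := by
  ext i; fin_cases i <;> rfl

theorem update_pair_one {V : Type*} (a b c : V) : Function.update ![a, b] 1 c = ![a, c] := by
  ext i; fin_cases i <;> rfl

theorem exists_eq_of_nondegenerate {V : Type*} [NormedAddCommGroup V] [NormedSpace ℝ V]
    [FiniteDimensional ℝ V] (η : V [⋀^Fin 2]→L[ℝ] ℝ)
    (hη : ∀ v : V, (∀ w, η ![v, w] = 0) → v = 0) (ξ : V →L[ℝ] ℝ) :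
    ∃ v : V, ∀ w, η ![v, w] = ξ w := by
  let B : V →ₗ[ℝ] Module.Dual ℝ V :=
    LinearMap.mk₂ ℝ (fun v w : V => (η ![v, w] : ℝ))
      (fun v v' w => by
        have h := η.map_update_add ![0, w] 0 v v'
        rwa [update_pair_zero, update_pair_zero, update_pair_zero] at h)
      (fun a v w => by
        have h := η.map_update_smul ![0, w] 0 a v
        rwa [update_pair_zero, update_pair_zero] at h)
      (fun v w w' => by
        have h := η.map_update_add ![v, 0] 1 w w'
        rwa [update_pair_one, update_pair_one, update_pair_one] at h)
      (fun a v w => by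
        have h := η.map_update_smul ![v, 0] 1 a w
        rwa [update_pair_one, update_pair_one] at h)
  have hinj : Function.Injective B := by
    rw [← LinearMap.ker_eq_bot, LinearMap.ker_eq_bot']
    intro v hv
    exact hη v fun w => LinearMap.congr_fun hv w
  have hsurj : Function.Surjective B :=
    (LinearMap.injective_iff_surjective_of_finrank_eq_finrank
      (Subspace.dual_finrank_eq (K := ℝ) (V := V)).symm).1 hinj
  obtain ⟨v, hv⟩ := hsurj ξ.toLinearMap
  exact ⟨v, fun w => LinearMap.congr_fun hv w⟩

section Forms

variable {n : ℕ} {M : Type*} [TopologicalSpace M] [ChartedSpace (EuclideanSpace ℝ (Fin n)) M]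

/-- The local representative of a differential `k`-form in the preferred chart at `c`: its pullback
under the inverse of the chart, as a `k`-form on (the chart's target in) `ℝⁿ`. -/
def chartForm {k : ℕ} (η : ∀ x : M, TangentSpace (𝓡 n) x [⋀^Fin k]→L[ℝ] ℝ) (c : M)
    (y : EuclideanSpace ℝ (Fin n)) : EuclideanSpace ℝ (Fin n) [⋀^Fin k]→L[ℝ] ℝ :=
  (η ((chartAt (EuclideanSpace ℝ (Fin n)) c).symm y)).compContinuousLinearMap
    (mfderiv (𝓡 n) (𝓡 n) (chartAt (EuclideanSpace ℝ (Fin n)) c).symm y)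

/-- A `k`-form is smooth if its local representatives are smooth. -/
def IsSmoothForm {k : ℕ} (η : ∀ x : M, TangentSpace (𝓡 n) x [⋀^Fin k]→L[ℝ] ℝ) : Prop :=
  ∀ c : M, ContDiffOn ℝ ∞ (chartForm η c) (chartAt (EuclideanSpace ℝ (Fin n)) c).target

/-- A (smooth) `k`-form is closed if the exterior derivatives of its local representatives
vanish. -/
def IsClosedForm {k : ℕ} (η : ∀ x : M, TangentSpace (𝓡 n) x [⋀^Fin k]→L[ℝ] ℝ) : Prop :=
  ∀ c : M, ∀ y ∈ (chartAt (EuclideanSpace ℝ (Fin n)) c).target, extDeriv (chartForm η c) y = 0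

/-- The contraction `i_X σ` of a `2`-form with a vector field. -/
def interior₂ (σ : ∀ x : M, TangentSpace (𝓡 n) x [⋀^Fin 2]→L[ℝ] ℝ)
    (X : ∀ x : M, TangentSpace (𝓡 n) x) (x : M) : TangentSpace (𝓡 n) x [⋀^Fin 1]→L[ℝ] ℝ :=
  ContinuousAlternatingMap.ofSubsingleton ℝ (TangentSpace (𝓡 n) x) ℝ (0 : Fin 1)
    ((σ x).toContinuousLinearMap ![X x, 0] 1)

theorem interior₂_apply (σ : ∀ x : M, TangentSpace (𝓡 n) x [⋀^Fin 2]→L[ℝ] ℝ)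
    (X : ∀ x : M, TangentSpace (𝓡 n) x) (x : M) (v : Fin 1 → TangentSpace (𝓡 n) x) :
    interior₂ σ X x v = σ x ![X x, v 0] := by
  have h := update_pair_one (X x) 0 (v 0)
  simp only [interior₂, ContinuousAlternatingMap.ofSubsingleton_apply_apply,
    ContinuousAlternatingMap.toContinuousLinearMap_apply]
  exact congrArg (σ x) h

/-- The differential `dH` of a real function, as a `1`-form. -/
def dForm (H : M → ℝ) (x : M) : TangentSpace (𝓡 n) x [⋀^Fin 1]→L[ℝ] ℝ :=
  ContinuousAlternatingMap.ofSubsingleton ℝ (TangentSpace (𝓡 n) x) ℝ (0 : Fin 1)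
    (mfderiv (𝓡 n) 𝓘(ℝ, ℝ) H x)

/-- A `1`-form is exact if it is the differential of a smooth real function. -/
def IsExactOneForm (α : ∀ x : M, TangentSpace (𝓡 n) x [⋀^Fin 1]→L[ℝ] ℝ) : Prop :=
  ∃ H : M → ℝ, ContMDiff (𝓡 n) 𝓘(ℝ, ℝ) ∞ H ∧ ∀ x, α x = dForm H x

end Forms

/-- A symplectic form: a smooth, closed, nondegenerate `2`-form. -/
structure SymplecticForm (n : ℕ) (M : Type*) [TopologicalSpace M]
    [ChartedSpace (EuclideanSpace ℝ (Fin n)) M] where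
  form : ∀ x : M, TangentSpace (𝓡 n) x [⋀^Fin 2]→L[ℝ] ℝ
  smooth : IsSmoothForm form
  closed : IsClosedForm form
  nondegenerate : ∀ x (v : TangentSpace (𝓡 n) x), (∀ w, form x ![v, w] = 0) → v = 0

/-- A symplectic vector field: a smooth vector field `X` for which `i_X σ` is closed. -/
structure SymplecticVectorField {n : ℕ} {M : Type*} [TopologicalSpace M]
    [ChartedSpace (EuclideanSpace ℝ (Fin n)) M] [IsManifold (𝓡 n) ∞ M]
    (σ : SymplecticForm n M) where
  field : ∀ x : M, TangentSpace (𝓡 n) x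
  smooth : ContMDiff (𝓡 n) (𝓡 n).tangent ∞ (fun x => (⟨x, field x⟩ : TangentBundle (𝓡 n) M))
  closed : IsClosedForm (interior₂ σ.form field)

/-! ## Smooth functions and the Poisson bracket -/

/-- The complex algebra `C^∞(M)` of smooth complex-valued functions. -/
def smoothFunctions (n : ℕ) (M : Type*) [TopologicalSpace M]
    [ChartedSpace (EuclideanSpace ℝ (Fin n)) M] : Subalgebra ℂ (M → ℂ) where
  carrier := {f | ContMDiff (𝓡 n) 𝓘(ℝ, ℂ) ∞ f}
  mul_mem' hf hg := contDiff_mul.contMDiff.comp (hf.prodMk_space hg)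
  add_mem' hf hg := contDiff_add.contMDiff.comp (hf.prodMk_space hg)
  algebraMap_mem' _ := contMDiff_const

/-- A real smooth function, as an element of `C^∞(M)`. -/
def ofRealSmooth {n : ℕ} {M : Type*} [TopologicalSpace M]
    [ChartedSpace (EuclideanSpace ℝ (Fin n)) M] (H : M → ℝ)
    (hH : ContMDiff (𝓡 n) 𝓘(ℝ, ℝ) ∞ H) : smoothFunctions n M :=
  ⟨fun x => (H x : ℂ), (Complex.ofRealCLM.contDiff.contMDiff).comp hH⟩

section Poisson

variable {n : ℕ} {M : Type*} [TopologicalSpace M] [ChartedSpace (EuclideanSpace ℝ (Fin n)) M]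

theorem SymplecticForm.exists_hamiltonianVector (σ : SymplecticForm n M) (x : M)
    (ξ : TangentSpace (𝓡 n) x →L[ℝ] ℝ) :
    ∃ v : TangentSpace (𝓡 n) x, ∀ w, σ.form x ![v, w] = ξ w := by
  exact exists_eq_of_nondegenerate (V := EuclideanSpace ℝ (Fin n)) (σ.form x)
    (σ.nondegenerate x) ξ

/-- The vector `v` with `σ(v, ·) = ξ` (unique by nondegeneracy). For `ξ = dg` this is the
Hamiltonian vector `X_g`, `i_{X_g} σ = dg`. -/
def SymplecticForm.hamiltonianVector (σ : SymplecticForm n M) (x : M)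
    (ξ : TangentSpace (𝓡 n) x →L[ℝ] ℝ) : TangentSpace (𝓡 n) x :=
  (σ.exists_hamiltonianVector x ξ).choose

/-- The differential at `x` of a complex function, as an `ℝ`-linear map to `ℂ`. -/
def complexDifferential (f : M → ℂ) (x : M) : TangentSpace (𝓡 n) x →L[ℝ] ℂ :=
  mfderiv (𝓡 n) 𝓘(ℝ, ℂ) f x

/-- The Poisson bracket `{f, g} = df(X_g)`, extended complex-bilinearly from real functions: with
`g = u + i v` it is `df(X_u) + i df(X_v)`. -/
def SymplecticForm.poisson (σ : SymplecticForm n M) (f g : M → ℂ) (x : M) : ℂ :=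
  complexDifferential f x
      (σ.hamiltonianVector x (Complex.reCLM.comp (complexDifferential g x))) +
    Complex.I * complexDifferential f x
      (σ.hamiltonianVector x (Complex.imCLM.comp (complexDifferential g x)))

end Poisson

/-! ## Formal functions, bidifferential operators and star products -/

/-- `C^∞(M)[[λ]]`. Here `PowerSeries.X` is `λ`, and `PowerSeries ℂ` is `ℂ[[λ]]`. -/
abbrev FormalFunctions (n : ℕ) (M : Type*) [TopologicalSpace M]
    [ChartedSpace (EuclideanSpace ℝ (Fin n)) M] : Type _ :=
  PowerSeries (smoothFunctions n M)

section Star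

variable {n : ℕ} {M : Type*} [TopologicalSpace M] [ChartedSpace (EuclideanSpace ℝ (Fin n)) M]

/-- The iterated partial derivative `∂_{I 0} ⋯ ∂_{I (k-1)} f` at `x`, in the coordinates of the
preferred chart at `c`. -/
def coordDeriv (c : M) {k : ℕ} (I : Fin k → Fin n) (f : M → ℂ) (x : M) : ℂ :=
  iteratedFDeriv ℝ k (f ∘ (chartAt (EuclideanSpace ℝ (Fin n)) c).symm)
    (chartAt (EuclideanSpace ℝ (Fin n)) c x) (fun i => EuclideanSpace.single (I i) (1 : ℝ))

/-- A bilinear map on `C^∞(M)` is a bidifferential operator if near every point it is, in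
coordinates, a finite sum of products of partial derivatives with smooth coefficients. -/
def IsBidifferential
    (B : smoothFunctions n M →ₗ[ℂ] smoothFunctions n M →ₗ[ℂ] smoothFunctions n M) : Prop :=
  ∀ c : M, ∃ (N : ℕ) (U : Set M)
    (a : ∀ k l : ℕ, (Fin k → Fin n) → (Fin l → Fin n) → M → ℂ),
    IsOpen U ∧ c ∈ U ∧ U ⊆ (chartAt (EuclideanSpace ℝ (Fin n)) c).source ∧
    (∀ k l I J, ContMDiffOn (𝓡 n) 𝓘(ℝ, ℂ) ∞ (a k l I J) U) ∧
    ∀ f g : smoothFunctions n M, ∀ x ∈ U, (B f g : M → ℂ) x =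
      ∑ k ∈ Finset.range (N + 1), ∑ l ∈ Finset.range (N + 1), ∑ I : Fin k → Fin n,
        ∑ J : Fin l → Fin n, a k l I J x * coordDeriv c I f x * coordDeriv c J g x

/-- The `ℂ[[λ]]`-bilinear product on `C^∞(M)[[λ]]` with
`f * g = ∑ᵣ λʳ Mᵣ(f, g)` for `f, g ∈ C^∞(M)`. -/
def formalProduct
    (B : ℕ → smoothFunctions n M →ₗ[ℂ] smoothFunctions n M →ₗ[ℂ] smoothFunctions n M)
    (F G : FormalFunctions n M) : FormalFunctions n M :=
  PowerSeries.mk fun m => ∑ p ∈ Finset.HasAntidiagonal.antidiagonal m,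
    ∑ q ∈ Finset.HasAntidiagonal.antidiagonal p.2,
      B p.1 (PowerSeries.coeff q.1 F) (PowerSeries.coeff q.2 G)

/-- A star product on a symplectic manifold. -/
structure StarProduct (σ : SymplecticForm n M) where
  /-- the bilinear operators `Mᵣ` -/
  op : ℕ → smoothFunctions n M →ₗ[ℂ] smoothFunctions n M →ₗ[ℂ] smoothFunctions n M
  bidifferential : ∀ r, IsBidifferential (op r)
  assoc : ∀ F G H : FormalFunctions n M,
    formalProduct op (formalProduct op F G) H = formalProduct op F (formalProduct op G H)
  op_zero : ∀ f g, op 0 f g = f * g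
  op_one : ∀ (f g : smoothFunctions n M) (x : M),
    (op 1 f g : M → ℂ) x - (op 1 g f : M → ℂ) x = Complex.I * σ.poisson f g x
  op_const_left : ∀ r, 1 ≤ r → ∀ g, op r 1 g = 0
  op_const_right : ∀ r, 1 ≤ r → ∀ f, op r f 1 = 0

/-- The star product `F * G`. -/
def StarProduct.mul {σ : SymplecticForm n M} (S : StarProduct σ) (F G : FormalFunctions n M) :
    FormalFunctions n M :=
  formalProduct S.op F G

/-- `ad(H) F = H * F - F * H`. -/
def StarProduct.ad {σ : SymplecticForm n M} (S : StarProduct σ) (H : smoothFunctions n M)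
    (F : FormalFunctions n M) : FormalFunctions n M :=
  S.mul (PowerSeries.C H) F - S.mul F (PowerSeries.C H)

/-- Bidifferential operators are local. -/
theorem IsBidifferential.congr_of_eventuallyEq
    {B : smoothFunctions n M →ₗ[ℂ] smoothFunctions n M →ₗ[ℂ] smoothFunctions n M}
    (hB : IsBidifferential B) {f f' g g' : smoothFunctions n M} {x : M}
    (hf : (f : M → ℂ) =ᶠ[𝓝 x] f') (hg : (g : M → ℂ) =ᶠ[𝓝 x] g') :
    (B f g : M → ℂ) x = (B f' g' : M → ℂ) x := by
  obtain ⟨N, U, a, -, hx, -, -, h⟩ := hB x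
  have key : ∀ {u u' : M → ℂ}, u =ᶠ[𝓝 x] u' → ∀ {k : ℕ} (I : Fin k → Fin n),
      coordDeriv x I u x = coordDeriv x I u' x := by
    intro u u' hu k I
    have ht : Filter.Tendsto (chartAt (EuclideanSpace ℝ (Fin n)) x).symm
        (𝓝 (chartAt (EuclideanSpace ℝ (Fin n)) x x)) (𝓝 x) := by
      have := (chartAt (EuclideanSpace ℝ (Fin n)) x).continuousAt_symm (mem_chart_target _ x)
      rwa [ContinuousAt, (chartAt (EuclideanSpace ℝ (Fin n)) x).left_inv
        (mem_chart_source _ x)] at this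
    have h1 : (u ∘ (chartAt (EuclideanSpace ℝ (Fin n)) x).symm)
        =ᶠ[𝓝 (chartAt (EuclideanSpace ℝ (Fin n)) x x)]
        (u' ∘ (chartAt (EuclideanSpace ℝ (Fin n)) x).symm) := hu.comp_tendsto ht
    unfold coordDeriv
    rw [(h1.iteratedFDeriv ℝ k).eq_of_nhds]
  rw [h f g x hx, h f' g' x hx]
  simp only [key hf, key hg]

/-- `C_0^∞(M)[[λ]]`: formal series all of whose coefficients have compact support. -/
def compactFormalFunctions (n : ℕ) (M : Type*) [TopologicalSpace M]
    [ChartedSpace (EuclideanSpace ℝ (Fin n)) M] :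
    Submodule (PowerSeries ℂ) (FormalFunctions n M) where
  carrier := {F | ∀ r, HasCompactSupport ((PowerSeries.coeff r F : smoothFunctions n M) : M → ℂ)}
  add_mem' hF hG r := by
    simpa using (hF r).add (hG r)
  zero_mem' r := by
    simpa using (HasCompactSupport.zero : HasCompactSupport (0 : M → ℂ))
  smul_mem' c F hF r := by
    rw [Algebra.smul_def, PowerSeries.coeff_mul]
    have : ∀ s : Finset (ℕ × ℕ), HasCompactSupport ((∑ p ∈ s,
        (PowerSeries.coeff p.1 (algebraMap (PowerSeries ℂ) (FormalFunctions n M) c)) *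
          PowerSeries.coeff p.2 F : smoothFunctions n M) : M → ℂ) := by
      intro s
      induction s using Finset.induction_on with
      | empty => simpa using (HasCompactSupport.zero : HasCompactSupport (0 : M → ℂ))
      | insert p s hp ih =>
        rw [Finset.sum_insert hp]
        exact HasCompactSupport.add (HasCompactSupport.mul_left (hF p.2)) ih
    exact this _

theorem coeff_ad {σ : SymplecticForm n M} (S : StarProduct σ) (H : smoothFunctions n M)
    (F : FormalFunctions n M) (m : ℕ) :
    PowerSeries.coeff m (S.ad H F) = ∑ p ∈ Finset.HasAntidiagonal.antidiagonal m,
      (S.op p.1 H (PowerSeries.coeff p.2 F) - S.op p.1 (PowerSeries.coeff p.2 F) H) := by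
  have h1 : ∀ p : ℕ × ℕ, ∑ q ∈ Finset.HasAntidiagonal.antidiagonal p.2,
      S.op p.1 (PowerSeries.coeff q.1 (PowerSeries.C H)) (PowerSeries.coeff q.2 F) =
        S.op p.1 H (PowerSeries.coeff p.2 F) := by
    intro p
    rw [Finset.sum_eq_single (0, p.2)]
    · simp
    · rintro ⟨i, j⟩ hij hne
      have : i ≠ 0 := by
        rintro rfl
        simp at hij
        exact hne (by simp [hij])
      simp [PowerSeries.coeff_C, this]
    · simp
  have h2 : ∀ p : ℕ × ℕ, ∑ q ∈ Finset.HasAntidiagonal.antidiagonal p.2,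
      S.op p.1 (PowerSeries.coeff q.1 F) (PowerSeries.coeff q.2 (PowerSeries.C H)) =
        S.op p.1 (PowerSeries.coeff p.2 F) H := by
    intro p
    rw [Finset.sum_eq_single (p.2, 0)]
    · simp
    · rintro ⟨i, j⟩ hij hne
      have : j ≠ 0 := by
        rintro rfl
        simp at hij
        exact hne (by simp [hij])
      simp [PowerSeries.coeff_C, this]
    · simp
  rw [StarProduct.ad, map_sub, StarProduct.mul, StarProduct.mul, formalProduct, formalProduct,
    PowerSeries.coeff_mk, PowerSeries.coeff_mk, Finset.sum_sub_distrib]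
  simp only [h1, h2]

theorem op_one_comm {σ : SymplecticForm n M} (S : StarProduct σ) (r : ℕ)
    (f : smoothFunctions n M) : S.op r 1 f = S.op r f 1 := by
  rcases Nat.eq_zero_or_pos r with rfl | hr
  · rw [S.op_zero, S.op_zero, one_mul, mul_one]
  · rw [S.op_const_left r hr, S.op_const_right r hr]

theorem hasCompactSupport_sum {ι : Type*} (s : Finset ι) (g : ι → smoothFunctions n M)
    (h : ∀ i ∈ s, HasCompactSupport ((g i : smoothFunctions n M) : M → ℂ)) :
    HasCompactSupport ((∑ i ∈ s, g i : smoothFunctions n M) : M → ℂ) := by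
  classical
  induction s using Finset.induction_on with
  | empty => simpa using (HasCompactSupport.zero : HasCompactSupport (0 : M → ℂ))
  | insert i s hi ih =>
    rw [Finset.sum_insert hi]
    exact HasCompactSupport.add (h i (Finset.mem_insert_self i s))
      (ih fun j hj => h j (Finset.mem_insert_of_mem hj))

theorem IsBidifferential.hasCompactSupport_left [T2Space M]
    {B : smoothFunctions n M →ₗ[ℂ] smoothFunctions n M →ₗ[ℂ] smoothFunctions n M}
    (hB : IsBidifferential B) {f : smoothFunctions n M} (hf : HasCompactSupport (f : M → ℂ))
    (g : smoothFunctions n M) : HasCompactSupport ((B f g : smoothFunctions n M) : M → ℂ) := by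
  refine HasCompactSupport.intro hf fun x hx => ?_
  have h1 : (f : M → ℂ) =ᶠ[𝓝 x] ((0 : smoothFunctions n M) : M → ℂ) :=
    notMem_tsupport_iff_eventuallyEq.1 hx
  rw [hB.congr_of_eventuallyEq h1 (Filter.EventuallyEq.refl (𝓝 x) (g : M → ℂ))]
  simp

theorem formal_smul_coeff (c : PowerSeries ℂ) (F : FormalFunctions n M) (r : ℕ) :
    PowerSeries.coeff r (c • F) = ∑ p ∈ Finset.HasAntidiagonal.antidiagonal r,
      PowerSeries.coeff p.1 c • PowerSeries.coeff p.2 F := by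
  rw [Algebra.smul_def, PowerSeries.coeff_mul]
  refine Finset.sum_congr rfl fun p _ => ?_
  rw [Algebra.smul_def]
  rfl

end Star

/-! ## Local Hamiltonians of a symplectic vector field -/

section LocalHamiltonian

variable {n : ℕ} {M : Type*} [TopologicalSpace M] [ChartedSpace (EuclideanSpace ℝ (Fin n)) M]

theorem SymplecticForm.hamiltonianVector_spec (σ : SymplecticForm n M) (x : M)
    (ξ w : _) : σ.form x ![σ.hamiltonianVector x ξ, w] = ξ w :=
  (σ.exists_hamiltonianVector x ξ).choose_spec w

variable [IsManifold (𝓡 n) ∞ M]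

/-- `H` is a Hamiltonian for `X` near the point `x`: `i_X σ = dH` in a neighbourhood of `x`. -/
def IsLocalHamiltonian {σ : SymplecticForm n M} (X : SymplecticVectorField σ) (x : M)
    (H : M → ℝ) : Prop :=
  ContMDiff (𝓡 n) 𝓘(ℝ, ℝ) ∞ H ∧ ∀ᶠ y in 𝓝 x, interior₂ σ.form X.field y = dForm H y

theorem contDiff_curryLeft {V : Type*} [NormedAddCommGroup V] [NormedSpace ℝ V] (k : ℕ) :
    ContDiff ℝ ∞ (fun f : V [⋀^Fin (k + 1)]→L[ℝ] ℝ => f.curryLeft) :=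
  (IsLinearMap.with_bound ⟨fun _ _ => rfl, fun _ _ => rfl⟩ 1
    (fun f => by rw [one_mul]; exact f.norm_curryLeft.le)).contDiff

theorem exists_smooth_chartForm {σ : SymplecticForm n M} (X : SymplecticVectorField σ) (c : M) :
    ∃ A : EuclideanSpace ℝ (Fin n) → EuclideanSpace ℝ (Fin n) →L[ℝ] ℝ,
      ContDiffOn ℝ ∞ A (chartAt (EuclideanSpace ℝ (Fin n)) c).target ∧
      ∀ y ∈ (chartAt (EuclideanSpace ℝ (Fin n)) c).target,
        chartForm (interior₂ σ.form X.field) c y =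
          ContinuousAlternatingMap.ofSubsingletonLIE (𝕜 := ℝ) (E := EuclideanSpace ℝ (Fin n))
            (F := ℝ) (0 : Fin 1) (A y) := by
  set φ := chartAt (EuclideanSpace ℝ (Fin n)) c with hφ
  have hd : φ.MDifferentiable (𝓡 n) (𝓡 n) :=
    have : IsManifold (𝓡 n) 1 M := IsManifold.of_le (n := ∞) (by simp)
    mdifferentiable_chart c
  let Y : EuclideanSpace ℝ (Fin n) → EuclideanSpace ℝ (Fin n) := fun y =>
    VectorField.mpullback (𝓡 n) (𝓡 n) φ.symm X.field y
  have hinv : ∀ y ∈ φ.target, (mfderiv (𝓡 n) (𝓡 n) φ.symm y).IsInvertible :=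
    fun y hy => ⟨hd.symm.mfderiv hy, rfl⟩
  have hYsm : ContDiffOn ℝ ∞ Y φ.target := by
    intro y hy
    refine ContDiffAt.contDiffWithinAt ?_
    refine contMDiffAt_vectorSpace_iff_contDiffAt.1 ?_
    exact ContMDiffAt.mpullback_vectorField_preimage (n := ∞) (X.smooth _)
      ((contMDiffOn_chart_symm (I := 𝓡 n) (n := ∞) (x := c)).contMDiffAt
        (φ.open_target.mem_nhds hy)) (hinv y hy) (by simp)
  have hY : ∀ y ∈ φ.target, mfderiv (𝓡 n) (𝓡 n) φ.symm y (Y y) = X.field (φ.symm y) := by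
    intro y hy
    exact (hinv y hy).self_apply_inverse _
  let L := ContinuousAlternatingMap.ofSubsingletonLIE (𝕜 := ℝ) (E := EuclideanSpace ℝ (Fin n))
    (F := ℝ) (0 : Fin 1)
  let C := ContinuousAlternatingMap.curryLeftLI (𝕜 := ℝ) (E := EuclideanSpace ℝ (Fin n))
    (F := ℝ) (n := 1)
  refine ⟨fun y => L.symm (C (chartForm σ.form c y) (Y y)), ?_, ?_⟩
  · have h1 : ContDiffOn ℝ ∞ (fun y => C (chartForm σ.form c y)) φ.target :=
      (contDiff_curryLeft (V := EuclideanSpace ℝ (Fin n)) 1).comp_contDiffOn (σ.smooth c)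
    have h2 : ContDiffOn ℝ ∞ (fun y => (C (chartForm σ.form c y)) (Y y)) φ.target :=
      h1.clm_apply hYsm
    exact ContDiff.comp_contDiffOn (g := fun z => L.symm z) L.symm.contDiff h2
  · intro y hy
    change _ = L (L.symm (C (chartForm σ.form c y) (Y y)))
    rw [L.apply_symm_apply]
    ext v
    change interior₂ σ.form X.field (φ.symm y) (fun i => mfderiv (𝓡 n) (𝓡 n) φ.symm y (v i)) =
      σ.form (φ.symm y) (fun i => mfderiv (𝓡 n) (𝓡 n) φ.symm y
        ((Matrix.vecCons (Y y) v : Fin 2 → EuclideanSpace ℝ (Fin n)) i))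
    rw [interior₂_apply, ← hY y hy]
    congr 1
    ext1 i
    fin_cases i <;> rfl

theorem fderiv_symm_of_extDeriv_eq_zero {V : Type*} [NormedAddCommGroup V] [NormedSpace ℝ V]
    {A : V → V →L[ℝ] ℝ} {η : V → V [⋀^Fin 1]→L[ℝ] ℝ} {y : V} (hA : DifferentiableAt ℝ A y)
    (hη : η =ᶠ[𝓝 y] fun z => ContinuousAlternatingMap.ofSubsingletonLIE (𝕜 := ℝ) (E := V)
      (F := ℝ) (0 : Fin 1) (A z)) (h0 : extDeriv η y = 0) (a b : V) :
    fderiv ℝ A y a b = fderiv ℝ A y b a := by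
  rw [hη.extDeriv_eq] at h0
  have hd : DifferentiableAt ℝ (fun z => ContinuousAlternatingMap.ofSubsingletonLIE (𝕜 := ℝ)
      (E := V) (F := ℝ) (0 : Fin 1) (A z)) y :=
    (ContinuousAlternatingMap.ofSubsingletonLIE (𝕜 := ℝ)
      (E := V) (F := ℝ) (0 : Fin 1)).differentiableAt.comp y hA
  have h1 := extDeriv_apply hd ![a, b]
  rw [h0] at h1
  have h2 : ∀ u v : V, fderiv ℝ (fun z => A z u) y v = fderiv ℝ A y v u := by
    intro u v
    rw [fderiv_clm_apply hA (differentiableAt_const u)]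
    simp
  have e0 : ∀ z, (ContinuousAlternatingMap.ofSubsingletonLIE (𝕜 := ℝ) (E := V) (F := ℝ)
      (0 : Fin 1) (A z)) (Fin.removeNth 0 ![a, b]) = A z b := fun z => rfl
  have e1 : ∀ z, (ContinuousAlternatingMap.ofSubsingletonLIE (𝕜 := ℝ) (E := V) (F := ℝ)
      (0 : Fin 1) (A z)) (Fin.removeNth 1 ![a, b]) = A z a := fun z => rfl
  rw [Fin.sum_univ_two] at h1
  simp only [e0, e1, h2] at h1
  simp at h1
  linarith

theorem exists_isLocalHamiltonian [T2Space M] {σ : SymplecticForm n M} (X : SymplecticVectorField σ)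
    (c : M) : ∃ H : M → ℝ, IsLocalHamiltonian X c H := by
  obtain ⟨A, hAs, hA⟩ := exists_smooth_chartForm X c
  set φ := chartAt (EuclideanSpace ℝ (Fin n)) c with hφ
  have : IsManifold (𝓡 n) 1 M := IsManifold.of_le (n := ∞) (by simp)
  have hd : φ.MDifferentiable (𝓡 n) (𝓡 n) := mdifferentiable_chart c
  obtain ⟨ε, hε, hball⟩ := Metric.isOpen_iff.1 φ.open_target (φ c) (mem_chart_target _ c)
  set s := Metric.ball (φ c) ε with hs
  have hso : IsOpen s := Metric.isOpen_ball
  have hAd : DifferentiableOn ℝ A s := (hAs.mono hball).differentiableOn (by simp)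
  obtain ⟨f, hf⟩ := (convex_ball (φ c) ε).exists_forall_hasFDerivAt_of_fderiv_symmetric hso hAd
    (fun y hy a b => fderiv_symm_of_extDeriv_eq_zero (hAd.differentiableAt (hso.mem_nhds hy))
      (Filter.eventually_of_mem (φ.open_target.mem_nhds (hball hy)) hA)
      (X.closed c y (hball hy)) a b)
  have hfs : ContDiffOn ℝ ∞ f s := by
    rw [contDiffOn_infty_iff_fderiv_of_isOpen hso]
    exact ⟨fun y hy => (hf y hy).differentiableAt.differentiableWithinAt,
      (hAs.mono hball).congr fun y hy => (hf y hy).fderiv⟩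
  have hU : IsOpen (φ.source ∩ φ ⁻¹' s) := φ.isOpen_inter_preimage hso
  have hcU : c ∈ φ.source ∩ φ ⁻¹' s := ⟨mem_chart_source _ c, Metric.mem_ball_self hε⟩
  obtain ⟨b, -, hb⟩ := (SmoothBumpFunction.nhds_basis_tsupport (I := 𝓡 n) c).mem_iff.1
    (hU.mem_nhds hcU)
  have hfφ : ∀ x ∈ φ.source ∩ φ ⁻¹' s, ContMDiffAt (𝓡 n) 𝓘(ℝ, ℝ) ∞ (f ∘ φ) x := by
    intro x hx
    exact ((hfs.contDiffAt (hso.mem_nhds hx.2)).contMDiffAt).comp x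
      ((contMDiffOn_chart (I := 𝓡 n) (n := ∞) (x := c)).contMDiffAt
        (φ.open_source.mem_nhds hx.1))
  refine ⟨fun x => b x • (f ∘ φ) x, ?_, ?_⟩
  · refine contMDiff_of_tsupport fun x hx => ?_
    have hx' : x ∈ tsupport b := (tsupport_smul_subset_left (b : M → ℝ) (f ∘ φ)) hx
    exact b.contMDiff.contMDiffAt.smul (hfφ x (hb hx'))
  · have h1 : ∀ᶠ y in 𝓝 c, (b : M → ℝ) =ᶠ[𝓝 y] 1 := b.eventuallyEq_one.eventually_nhds
    filter_upwards [h1, hU.mem_nhds hcU] with y hy hyU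
    have h2 : (fun x => b x • (f ∘ φ) x) =ᶠ[𝓝 y] f ∘ φ := by
      filter_upwards [hy] with z hz
      simp [hz]
    have h3 : mfderiv (𝓡 n) 𝓘(ℝ, ℝ) (fun x => b x • (f ∘ φ) x) y =
        (A (φ y)).comp (mfderiv (𝓡 n) (𝓡 n) φ y) := by
      rw [h2.mfderiv_eq, mfderiv_comp (I' := 𝓡 n) y
        (hf _ hyU.2).differentiableAt.mdifferentiableAt (hd.mdifferentiableAt hyU.1),
        mfderiv_eq_fderiv, (hf _ hyU.2).fderiv]
      rfl
    have h4 := hA (φ y) (hball hyU.2)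
    ext v
    have h5 := DFunLike.congr_fun h4 (fun i => mfderiv (𝓡 n) (𝓡 n) φ y (v i))
    have h6 : ∀ w, mfderiv (𝓡 n) (𝓡 n) φ.symm (φ y) (mfderiv (𝓡 n) (𝓡 n) φ y w) = w := fun w =>
      DFunLike.congr_fun (hd.symm_comp_deriv hyU.1) w
    let G : M → (Fin 1 → EuclideanSpace ℝ (Fin n)) → ℝ := fun z u =>
      interior₂ σ.form X.field z u
    have h7 : G (φ.symm (φ y)) (fun i => mfderiv (𝓡 n) (𝓡 n) φ.symm (φ y)
        (mfderiv (𝓡 n) (𝓡 n) φ y (v i))) = A (φ y) (mfderiv (𝓡 n) (𝓡 n) φ y (v 0)) := h5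
    have h8 : (fun i => mfderiv (𝓡 n) (𝓡 n) φ.symm (φ y)
        (mfderiv (𝓡 n) (𝓡 n) φ y (v i))) = v := funext fun i => h6 (v i)
    have h9 : G y v = A (φ y) (mfderiv (𝓡 n) (𝓡 n) φ y (v 0)) := by
      rw [← h7, φ.left_inv hyU.1]
      exact congrArg (G y) h8.symm
    change G y v = mfderiv (𝓡 n) 𝓘(ℝ, ℝ) (fun x => b x • (f ∘ φ) x) y (v 0)
    rw [h3, h9]
    rfl

theorem eventuallyEq_add_const_of_dForm_eq {H H' : M → ℝ}
    (hH : ContMDiff (𝓡 n) 𝓘(ℝ, ℝ) ∞ H) (hH' : ContMDiff (𝓡 n) 𝓘(ℝ, ℝ) ∞ H') {x : M}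
    (h : ∀ᶠ y in 𝓝 x, dForm (n := n) H y = dForm H' y) :
    ∃ a : ℝ, ∀ᶠ y in 𝓝 x, H y = H' y + a := by
  set φ := chartAt (EuclideanSpace ℝ (Fin n)) x with hφ
  have : IsManifold (𝓡 n) 1 M := IsManifold.of_le (n := ∞) (by simp)
  have hd : φ.MDifferentiable (𝓡 n) (𝓡 n) := mdifferentiable_chart x
  have ht : Filter.Tendsto φ.symm (𝓝 (φ x)) (𝓝 x) := by
    have := φ.continuousAt_symm (mem_chart_target _ x)
    rwa [ContinuousAt, φ.left_inv (mem_chart_source _ x)] at this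
  obtain ⟨ε, hε, hball⟩ := Metric.mem_nhds_iff.1
    ((ht.eventually h).and (φ.open_target.mem_nhds (mem_chart_target _ x)))
  set s := Metric.ball (φ x) ε with hs
  have hso : IsOpen s := Metric.isOpen_ball
  have hder : ∀ {K : M → ℝ}, ContMDiff (𝓡 n) 𝓘(ℝ, ℝ) ∞ K → ∀ y ∈ s,
      MDifferentiableAt (𝓡 n) 𝓘(ℝ, ℝ) (K ∘ φ.symm) y ∧
      fderiv ℝ (K ∘ φ.symm) y =
        (mfderiv (𝓡 n) 𝓘(ℝ, ℝ) K (φ.symm y)).comp (mfderiv (𝓡 n) (𝓡 n) φ.symm y) := by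
    intro K hK y hy
    have h1 : MDifferentiableAt (𝓡 n) 𝓘(ℝ, ℝ) K (φ.symm y) :=
      (hK _).mdifferentiableAt (by simp)
    have h2 := hd.mdifferentiableAt_symm (hball hy).2
    refine ⟨h1.comp y h2, ?_⟩
    rw [← mfderiv_eq_fderiv, mfderiv_comp (I' := 𝓡 n) y h1 h2]
  have hdiff : ∀ {K : M → ℝ}, ContMDiff (𝓡 n) 𝓘(ℝ, ℝ) ∞ K →
      DifferentiableOn ℝ (K ∘ φ.symm) s := fun hK y hy =>
    (hder hK y hy).1.differentiableAt.differentiableWithinAt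
  obtain ⟨a, ha⟩ := hso.exists_eq_add_of_fderiv_eq (convex_ball _ _).isPreconnected
    (hdiff hH) (hdiff hH') (fun y hy => by
      rw [(hder hH y hy).2, (hder hH' y hy).2]
      have e : mfderiv (𝓡 n) 𝓘(ℝ, ℝ) H (φ.symm y) = mfderiv (𝓡 n) 𝓘(ℝ, ℝ) H' (φ.symm y) :=
        (ContinuousAlternatingMap.ofSubsingleton ℝ _ ℝ (0 : Fin 1)).injective (hball hy).1
      exact congrArg (fun T : EuclideanSpace ℝ (Fin n) →L[ℝ] ℝ =>
        T.comp (mfderiv (𝓡 n) (𝓡 n) φ.symm y : EuclideanSpace ℝ (Fin n) →L[ℝ] _)) e)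
  refine ⟨a, ?_⟩
  have hx : φ.source ∩ φ ⁻¹' s ∈ 𝓝 x :=
    (φ.isOpen_inter_preimage hso).mem_nhds ⟨mem_chart_source _ x, Metric.mem_ball_self hε⟩
  filter_upwards [hx] with y hy
  have := ha hy.2
  simpa [φ.left_inv hy.1] using this

theorem coeff_ad_congr {σ : SymplecticForm n M} (S : StarProduct σ)
    {H H' : M → ℝ} (hH : ContMDiff (𝓡 n) 𝓘(ℝ, ℝ) ∞ H) (hH' : ContMDiff (𝓡 n) 𝓘(ℝ, ℝ) ∞ H')
    {x : M} (h : ∀ᶠ y in 𝓝 x, dForm (n := n) H y = dForm H' y)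
    (F : FormalFunctions n M) (m : ℕ) :
    (PowerSeries.coeff m (S.ad (ofRealSmooth H hH) F) : smoothFunctions n M).1 x =
      (PowerSeries.coeff m (S.ad (ofRealSmooth H' hH') F) : smoothFunctions n M).1 x := by
  obtain ⟨a, ha⟩ := eventuallyEq_add_const_of_dForm_eq hH hH' h
  have hev : ((ofRealSmooth H hH : smoothFunctions n M) : M → ℂ) =ᶠ[𝓝 x]
      ((ofRealSmooth H' hH' + (a : ℂ) • 1 : smoothFunctions n M) : M → ℂ) := by
    filter_upwards [ha] with y hy
    simp [ofRealSmooth, hy]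
  have key : ∀ (r : ℕ) (f : smoothFunctions n M),
      (S.op r (ofRealSmooth H hH) f - S.op r f (ofRealSmooth H hH) : smoothFunctions n M).1 x =
      (S.op r (ofRealSmooth H' hH') f - S.op r f (ofRealSmooth H' hH') :
        smoothFunctions n M).1 x := by
    intro r f
    have e1 := (S.bidifferential r).congr_of_eventuallyEq hev
      (Filter.EventuallyEq.refl (𝓝 x) (f : M → ℂ))
    have e2 := (S.bidifferential r).congr_of_eventuallyEq
      (Filter.EventuallyEq.refl (𝓝 x) (f : M → ℂ)) hev
    have e3 := congrArg (fun g : smoothFunctions n M => g.1 x) (op_one_comm S r f)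
    simp only [map_add, map_smul, LinearMap.add_apply, LinearMap.smul_apply] at e1 e2
    change (S.op r (ofRealSmooth H hH) f).1 x - (S.op r f (ofRealSmooth H hH)).1 x =
      (S.op r (ofRealSmooth H' hH') f).1 x - (S.op r f (ofRealSmooth H' hH')).1 x
    change (S.op r (ofRealSmooth H hH) f).1 x =
      (S.op r (ofRealSmooth H' hH') f).1 x + (a : ℂ) * (S.op r 1 f).1 x at e1
    change (S.op r f (ofRealSmooth H hH)).1 x =
      (S.op r f (ofRealSmooth H' hH')).1 x + (a : ℂ) * (S.op r f 1).1 x at e2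
    rw [e1, e2]
    linear_combination (a : ℂ) * e3
  rw [coeff_ad, coeff_ad]
  have hs : ∀ g : ℕ × ℕ → smoothFunctions n M, ∀ s : Finset (ℕ × ℕ),
      (∑ p ∈ s, g p : smoothFunctions n M).1 x = ∑ p ∈ s, (g p).1 x := by
    intro g s
    rw [AddSubmonoidClass.coe_finsetSum, Finset.sum_apply]
  rw [hs, hs]
  exact Finset.sum_congr rfl fun p _ => key _ _

variable [T2Space M]

/-- A Hamiltonian for `X` near `x`. -/
def SymplecticVectorField.localHamiltonian {σ : SymplecticForm n M} (X : SymplecticVectorField σ)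
    (x : M) : M → ℝ :=
  (exists_isLocalHamiltonian X x).choose

theorem SymplecticVectorField.localHamiltonian_spec {σ : SymplecticForm n M}
    (X : SymplecticVectorField σ) (x : M) : IsLocalHamiltonian X x (X.localHamiltonian x) :=
  (exists_isLocalHamiltonian X x).choose_spec

/-- The value at `x` of the `m`-th coefficient of `δ_X F`: that of `ad(H) F`, for a local
Hamiltonian `H` of `X` near `x`. -/
def deltaCoeff {σ : SymplecticForm n M} (S : StarProduct σ) (X : SymplecticVectorField σ)
    (F : FormalFunctions n M) (m : ℕ) (x : M) : ℂ :=
  (PowerSeries.coeff m (S.ad (ofRealSmooth (X.localHamiltonian x)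
    (X.localHamiltonian_spec x).1) F) : smoothFunctions n M).1 x

theorem deltaCoeff_eq {σ : SymplecticForm n M} (S : StarProduct σ) (X : SymplecticVectorField σ)
    (F : FormalFunctions n M) (m : ℕ) {x : M} {H : M → ℝ} (hH : IsLocalHamiltonian X x H) :
    deltaCoeff S X F m x =
      (PowerSeries.coeff m (S.ad (ofRealSmooth H hH.1) F) : smoothFunctions n M).1 x := by
  refine coeff_ad_congr S _ _ ?_ F m
  filter_upwards [(X.localHamiltonian_spec x).2, hH.2] with y h1 h2
  rw [← h1, ← h2]

theorem contMDiff_deltaCoeff {σ : SymplecticForm n M} (S : StarProduct σ)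
    (X : SymplecticVectorField σ) (F : FormalFunctions n M) (m : ℕ) :
    ContMDiff (𝓡 n) 𝓘(ℝ, ℂ) ∞ (deltaCoeff S X F m) := by
  intro x
  have hx := X.localHamiltonian_spec x
  have h1 : deltaCoeff S X F m =ᶠ[𝓝 x] (PowerSeries.coeff m
      (S.ad (ofRealSmooth (X.localHamiltonian x) hx.1) F) : smoothFunctions n M).1 := by
    filter_upwards [hx.2.eventually_nhds] with y hy
    exact deltaCoeff_eq S X F m ⟨hx.1, hy⟩
  exact ((PowerSeries.coeff m (S.ad (ofRealSmooth (X.localHamiltonian x) hx.1) F) :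
    smoothFunctions n M).2 x).congr_of_eventuallyEq h1

/-- The derivation `δ_X` of the star product induced by a symplectic vector field: the globally
defined map which is `ad(H)` wherever `i_X σ = dH`. -/
def delta {σ : SymplecticForm n M} (S : StarProduct σ) (X : SymplecticVectorField σ)
    (F : FormalFunctions n M) : FormalFunctions n M :=
  PowerSeries.mk fun m => ⟨deltaCoeff S X F m, contMDiff_deltaCoeff S X F m⟩

/-- `δ_X` is `ad(H)` wherever `H` is a Hamiltonian for `X`. -/
theorem delta_eq_ad {σ : SymplecticForm n M} (S : StarProduct σ) (X : SymplecticVectorField σ)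
    (F : FormalFunctions n M) (m : ℕ) {x : M} {H : M → ℝ} (hH : IsLocalHamiltonian X x H) :
    (PowerSeries.coeff m (delta S X F) : smoothFunctions n M).1 x =
      (PowerSeries.coeff m (S.ad (ofRealSmooth H hH.1) F) : smoothFunctions n M).1 x := by
  rw [delta, PowerSeries.coeff_mk]
  exact deltaCoeff_eq S X F m hH

/-- `δ_X` raises the order in `λ` at least by one. -/
theorem coeff_delta_eq_zero {σ : SymplecticForm n M} (S : StarProduct σ)
    (X : SymplecticVectorField σ) (F : FormalFunctions n M) (m : ℕ)
    (hF : ∀ j < m, PowerSeries.coeff j F = 0) : PowerSeries.coeff m (delta S X F) = 0 := by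
  refine Subtype.ext (funext fun x => ?_)
  rw [delta_eq_ad S X F m (X.localHamiltonian_spec x), coeff_ad, Finset.sum_eq_zero]
  rintro ⟨i, j⟩ hij
  rw [Finset.HasAntidiagonal.mem_antidiagonal] at hij
  rcases Nat.lt_or_ge j m with hj | hj
  · simp [hF j hj]
  · obtain rfl : i = 0 := by simp at hij; omega
    simp [S.op_zero, mul_comm]

theorem coeff_delta_iterate_eq_zero {σ : SymplecticForm n M} (S : StarProduct σ)
    (X : SymplecticVectorField σ) (F : FormalFunctions n M) (r : ℕ) :
    ∀ m < r, PowerSeries.coeff m ((delta S X)^[r] F) = 0 := by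
  induction r with
  | zero => intro m hm; omega
  | succ r ih =>
    intro m hm
    rw [Function.iterate_succ_apply']
    exact coeff_delta_eq_zero S X _ m fun j hj => ih j (by omega)

/-- The formal series of maps `e^{β δ_X} = ∑ᵣ (β δ_X)ʳ / r!`. Since `δ_X` raises the order in `λ`,
only the terms with `r ≤ m` contribute to the coefficient of `λᵐ`. -/
def expDelta {σ : SymplecticForm n M} (S : StarProduct σ) (X : SymplecticVectorField σ) (β : ℝ)
    (F : FormalFunctions n M) : FormalFunctions n M :=
  PowerSeries.mk fun m => ∑ r ∈ Finset.range (m + 1),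
    ((β ^ r / (r.factorial : ℝ) : ℝ) : ℂ) • PowerSeries.coeff m ((delta S X)^[r] F)

/-! ## The static formal KMS condition -/

/-- `C_0^∞(M)[[λ]]` is a right ideal for the star product. -/
theorem StarProduct.mul_mem_compact {σ : SymplecticForm n M} (S : StarProduct σ)
    {F : FormalFunctions n M} (hF : F ∈ compactFormalFunctions n M) (G : FormalFunctions n M) :
    S.mul F G ∈ compactFormalFunctions n M := by
  intro m
  rw [StarProduct.mul, formalProduct, PowerSeries.coeff_mk]
  exact hasCompactSupport_sum _ _ fun p _ => hasCompactSupport_sum _ _ fun q _ =>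
    (S.bidifferential p.1).hasCompactSupport_left (hF q.1) _

/-- The static formal KMS condition for the inverse temperature `β` with respect to `X`:
`μ(F * G) = μ(G * e^{β δ_X} F)` for all `F, G ∈ C_0^∞(M)[[λ]]`. -/
def IsStaticKMS {σ : SymplecticForm n M} (S : StarProduct σ) (X : SymplecticVectorField σ)
    (β : ℝ) (μ : compactFormalFunctions n M →ₗ[PowerSeries ℂ] PowerSeries ℂ) : Prop :=
  ∀ F G : compactFormalFunctions n M,
    μ ⟨S.mul F G, S.mul_mem_compact F.2 G⟩ =
      μ ⟨S.mul G (expDelta S X β F), S.mul_mem_compact G.2 (expDelta S X β F)⟩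

end LocalHamiltonian
end

/-!
Only the lowest order of the formal KMS condition is needed. A nonzero `μ` has a lowest coefficient
`T : C_0^∞(M) → ℂ` that is not zero, and comparing the next order of the two sides of the KMS
condition gives the classical KMS condition `T {f, g} = β T (f · dg(X))`
(`exists_classical_KMS`). No continuity of `T` is available, so everything below is algebraic
in `T`.

In a chart, let `ω` be the matrix of the symplectic form, `ρ = |det ω|^{1/2}` the Liouville density
and `H` a local Hamiltonian of `X`. Applying the classical condition to the pairs
`(ω_{kj} F, y_j)` and summing over `j` gives `T (ρ⁻¹ ∂_k (ρ F)) = -β T (F ∂_k H)`, because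
`dω = 0` and Jacobi's formula for the determinant identify the divergence of `ω⁻¹` with a
logarithmic derivative of `ρ`. Hence `G ↦ T (G / (ρ e^{βH}))` kills all partial derivatives
(`apply_pullChart_fderiv_eq_zero`). A linear functional with this property is locally a multiple
of the integral, as `f ∫ g - g ∫ f` is the divergence of an explicit compactly supported field
(`exists_eq_const_mul_integral`). So locally `T` is integration against `κ e^{βH}` times the
Liouville volume (`exists_isBoltzmannOn`).

The Liouville volume does not depend on the chart, hence neither does the function
`K = κ e^{βH}` on overlaps (`IsBoltzmannOn.eq_on_overlap`). Its zero set is open and closed, and is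
not all of the connected manifold since `T ≠ 0`. Therefore `log |K| / β` is globally defined, and it
differs from each local Hamiltonian by a constant: it is a Hamiltonian of `X`.
-/

noncomputable section

/-! ### Integrals depending smoothly on a parameter -/

section ParametricIntegral

open MeasureTheory

variable {P G : Type*} [NormedAddCommGroup P] [NormedSpace ℝ P] [NormedAddCommGroup G]
  [NormedSpace ℝ G] [MeasurableSpace G] [BorelSpace G]

/-- Smooth dependence of an integral on a parameter, by reading it as the value at `0` of a
convolution with the constant function `1`. -/
theorem contDiff_integral_of_compact (μ : Measure G) [IsLocallyFiniteMeasure μ]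
    {Φ : P → G → ℂ} (hΦ : ContDiff ℝ ∞ (fun q : P × G => Φ q.1 q.2)) {K : Set G}
    (hK : IsCompact K) (h0 : ∀ p, ∀ x ∉ K, Φ p x = 0) :
    ContDiff ℝ ∞ (fun p => ∫ x, Φ p x ∂μ) := by
  have h := contDiffOn_convolution_right_with_param (μ := μ) (n := ⊤) (f := fun _ : G => (1 : ℝ))
    (ContinuousLinearMap.lsmul ℝ ℝ : ℝ →L[ℝ] ℂ →L[ℝ] ℂ) (g := fun p x => Φ p (-x))
    (s := Set.univ) (k := -K) isOpen_univ hK.neg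
    (fun p x _ hx => h0 p _ (by simpa using hx)) (locallyIntegrable_const 1)
    (hΦ.comp (contDiff_fst.prodMk contDiff_snd.neg)).contDiffOn
  rw [Set.univ_prod_univ, contDiffOn_univ] at h
  have h2 := ContDiff.comp h
    (contDiff_id.prodMk contDiff_const : ContDiff ℝ ∞ fun p : P => (p, (0 : G)))
  convert! h2 using 2 with p
  simp [convolution]

theorem fderiv_integral_of_compact [ProperSpace P] (μ : Measure G) [IsLocallyFiniteMeasure μ]
    [SecondCountableTopology G]
    {Φ : P → G → ℂ} (hΦ : ContDiff ℝ ∞ (fun q : P × G => Φ q.1 q.2)) {K : Set G}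
    (hK : IsCompact K) (h0 : ∀ p, ∀ x ∉ K, Φ p x = 0) (p w : P) :
    fderiv ℝ (fun p => ∫ x, Φ p x ∂μ) p w = ∫ x, fderiv ℝ (fun p => Φ p x) p w ∂μ := by
  have hp : ∀ p x, HasFDerivAt (fun p => Φ p x)
      ((fderiv ℝ (fun q : P × G => Φ q.1 q.2) (p, x)).comp (ContinuousLinearMap.inl ℝ P G)) p :=
    fun p x => ((hΦ.differentiable (by simp) (p, x)).hasFDerivAt).comp
      (f := fun p => (p, x)) p (hasFDerivAt_prodMk_left p x)
  have hcont : Continuous fun q : P × G => fderiv ℝ (fun p => Φ p q.2) q.1 := by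
    simp only [(hp _ _).fderiv]
    exact (hΦ.continuous_fderiv (by simp)).clm_comp continuous_const
  have hz : ∀ p, ∀ x ∉ K, fderiv ℝ (fun p => Φ p x) p = 0 := by
    intro p x hx
    have : (fun p => Φ p x) = fun _ => 0 := funext fun p => h0 p x hx
    rw [this]; simp
  have hint : ∀ p, Integrable (fun x => Φ p x) μ := fun p =>
    (hΦ.continuous.comp (Continuous.prodMk_right p)).integrable_of_hasCompactSupport
      (HasCompactSupport.intro hK fun x hx => h0 p x hx)
  have hc' : Continuous fun x => fderiv ℝ (fun p => Φ p x) p :=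
    hcont.comp (Continuous.prodMk_right p)
  have hint' : Integrable (fun x => fderiv ℝ (fun p => Φ p x) p) μ :=
    hc'.integrable_of_hasCompactSupport (HasCompactSupport.intro hK fun x hx => hz p x hx)
  obtain ⟨C, hC⟩ := ((isCompact_closedBall p 1).prod hK).exists_bound_of_continuousOn
    hcont.continuousOn
  have h := hasFDerivAt_integral_of_dominated_of_fderiv_le (𝕜 := ℝ) (μ := μ) (x₀ := p)
    (F := Φ) (F' := fun p x => fderiv ℝ (fun p => Φ p x) p) (s := Metric.closedBall p 1)
    (bound := K.indicator fun _ => C) (Metric.closedBall_mem_nhds p one_pos)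
    (Filter.Eventually.of_forall fun q => (hint q).aestronglyMeasurable) (hint p)
    hint'.aestronglyMeasurable
    (Filter.Eventually.of_forall fun x q hq => by
      by_cases hx : x ∈ K
      · rw [Set.indicator_of_mem hx]
        exact hC (q, x) ⟨hq, hx⟩
      · rw [hz q x hx, Set.indicator_of_notMem hx, norm_zero])
    ((integrable_indicator_iff hK.measurableSet).2 (integrableOn_const hK.measure_lt_top.ne))
    (Filter.Eventually.of_forall fun x q _ => (hp q x).differentiableAt.hasFDerivAt)
  rw [h.fderiv, ContinuousLinearMap.integral_apply hint']

end ParametricIntegral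

/-! ### Functionals that kill derivatives -/

section Divergence

open MeasureTheory

variable {n : ℕ}

/-- The standard coordinate vector `e_k`. -/
abbrev stdVec (k : Fin n) : EuclideanSpace ℝ (Fin n) := EuclideanSpace.single k 1

theorem sum_apply_stdVec (L : EuclideanSpace ℝ (Fin n) →L[ℝ] ℂ) (v : EuclideanSpace ℝ (Fin n)) :
    ∑ k, ((v k : ℝ) : ℂ) * L (stdVec k) = L v := by
  conv_rhs => rw [← (EuclideanSpace.basisFun (Fin n) ℝ).sum_repr v, map_sum]
  refine Finset.sum_congr rfl fun k _ => ?_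
  simp [stdVec]

/-- `f ∫ g` and the convolution of `f` with `g` differ by a divergence, with potential
`W_k(y) = ∫ ∫_0^1 v_k g(p + v) f(y - t v) dt dv`. -/
theorem exists_divergence_convolution {f g : EuclideanSpace ℝ (Fin n) → ℂ}
    {p : EuclideanSpace ℝ (Fin n)} {r : ℝ} (hf : ContDiff ℝ ∞ f) (hg : ContDiff ℝ ∞ g)
    (hfs : tsupport f ⊆ Metric.closedBall p r) (hgs : tsupport g ⊆ Metric.closedBall p r) :
    ∃ W : Fin n → EuclideanSpace ℝ (Fin n) → ℂ, (∀ k, ContDiff ℝ ∞ (W k)) ∧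
      (∀ k, tsupport (W k) ⊆ Metric.closedBall p (2 * r)) ∧
      ∀ y, f y * (∫ v, g v) - ∫ v, g (p + v) * f (y - v) =
        ∑ k, fderiv ℝ (W k) y (stdVec k) := by
  have hf0 : ∀ y ∉ Metric.closedBall p r, f y = 0 := fun y hy =>
    image_eq_zero_of_notMem_tsupport fun h => hy (hfs h)
  have hg0 : ∀ y ∉ Metric.closedBall p r, g y = 0 := fun y hy =>
    image_eq_zero_of_notMem_tsupport fun h => hy (hgs h)
  have hgc : HasCompactSupport fun v => g (p + v) := by
    refine HasCompactSupport.intro (isCompact_closedBall (0 : EuclideanSpace ℝ (Fin n)) r) ?_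
    intro v hv
    exact hg0 _ (by simpa using hv)
  -- The cutoff `χ` is `1` on the range `(0, 1]` of `t`; it only makes the integrand compactly
  -- supported on the whole of `ℝⁿ × ℝ`.
  let χ : ContDiffBump (0 : ℝ) := ⟨1, 2, one_pos, one_lt_two⟩
  let S : Set (EuclideanSpace ℝ (Fin n) × ℝ) := Set.univ ×ˢ Set.Ioc 0 1
  have hS : MeasurableSet S := MeasurableSet.univ.prod measurableSet_Ioc
  let K : Set (EuclideanSpace ℝ (Fin n) × ℝ) := Metric.closedBall 0 r ×ˢ Metric.closedBall 0 2
  have hK : IsCompact K := (isCompact_closedBall _ _).prod (isCompact_closedBall _ _)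
  let Φ : Fin n → EuclideanSpace ℝ (Fin n) → EuclideanSpace ℝ (Fin n) × ℝ → ℂ := fun k y q =>
    ((q.1 k : ℝ) : ℂ) * (g (p + q.1) * ((χ q.2 : ℝ) : ℂ)) * f (y - q.2 • q.1)
  have hΦ : ∀ k, ContDiff ℝ ∞
      (fun q : EuclideanSpace ℝ (Fin n) × (EuclideanSpace ℝ (Fin n) × ℝ) => Φ k q.1 q.2) := by
    intro k
    have h1 : ContDiff ℝ ∞ fun q : EuclideanSpace ℝ (Fin n) × (EuclideanSpace ℝ (Fin n) × ℝ) =>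
        ((q.2.1 k : ℝ) : ℂ) := Complex.ofRealCLM.contDiff.comp (by fun_prop)
    have h2 : ContDiff ℝ ∞ fun q : EuclideanSpace ℝ (Fin n) × (EuclideanSpace ℝ (Fin n) × ℝ) =>
        g (p + q.2.1) := hg.comp (by fun_prop)
    have h3 : ContDiff ℝ ∞ fun q : EuclideanSpace ℝ (Fin n) × (EuclideanSpace ℝ (Fin n) × ℝ) =>
        ((χ q.2.2 : ℝ) : ℂ) := Complex.ofRealCLM.contDiff.comp (χ.contDiff.comp (by fun_prop))
    have h4 : ContDiff ℝ ∞ fun q : EuclideanSpace ℝ (Fin n) × (EuclideanSpace ℝ (Fin n) × ℝ) =>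
        f (q.1 - q.2.2 • q.2.1) := hf.comp (by fun_prop)
    exact (h1.mul (h2.mul h3)).mul h4
  have h0 : ∀ k y, ∀ q ∉ K, Φ k y q = 0 := by
    intro k y q hq
    by_cases h1 : q.1 ∈ Metric.closedBall (0 : EuclideanSpace ℝ (Fin n)) r
    · have h2 : q.2 ∉ Metric.closedBall (0 : ℝ) 2 := fun h2 => hq ⟨h1, h2⟩
      have : χ q.2 = 0 := χ.zero_of_le_dist (not_lt.1 fun h => h2 (Metric.ball_subset_closedBall h))
      simp [Φ, this]
    · have : g (p + q.1) = 0 := hg0 _ (by simpa using h1)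
      simp [Φ, this]
  let μ : Measure (EuclideanSpace ℝ (Fin n) × ℝ) := volume.restrict S
  have hdf : ∀ (t : ℝ) (v y : EuclideanSpace ℝ (Fin n)),
      HasFDerivAt (fun y => f (y - t • v)) (fderiv ℝ f (y - t • v)) y := fun t v y => 
    (hf.differentiable (by simp) (y - t • v)).hasFDerivAt.comp (f := fun y => y - t • v) y
      ((hasFDerivAt_id y).sub_const (t • v))
  refine ⟨fun k y => ∫ q, Φ k y q ∂μ, fun k => contDiff_integral_of_compact μ (hΦ k) hK (h0 k),
    fun k => ?_, fun y => ?_⟩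
  · refine closure_minimal (fun y hy => ?_) Metric.isClosed_closedBall
    by_contra hy'
    refine hy (setIntegral_eq_zero_of_forall_eq_zero fun q hq => ?_)
    by_cases h1 : q.1 ∈ Metric.closedBall (0 : EuclideanSpace ℝ (Fin n)) r
    · have h2 : f (y - q.2 • q.1) = 0 := by
        refine hf0 _ fun h2 => hy' ?_
        have ht : ‖q.2 • q.1‖ ≤ r := by
          rw [norm_smul, Real.norm_of_nonneg hq.2.1.le]
          have := mem_closedBall_zero_iff.1 h1
          nlinarith [norm_nonneg q.1, hq.2.2]
        rw [Metric.mem_closedBall, dist_eq_norm] at h2 ⊢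
        calc ‖y - p‖ = ‖(y - q.2 • q.1 - p) + q.2 • q.1‖ := by congr 1; abel
          _ ≤ 2 * r := (norm_add_le _ _).trans (by linarith)
      simp [Φ, h2]
    · have : g (p + q.1) = 0 := hg0 _ (by simpa using h1)
      simp [Φ, this]
  · have hder : ∀ k q, fderiv ℝ (fun y => Φ k y q) y (stdVec k) =
        (g (p + q.1) * ((χ q.2 : ℝ) : ℂ)) *
          (((q.1 k : ℝ) : ℂ) * fderiv ℝ f (y - q.2 • q.1) (stdVec k)) := by
      intro k q
      rw [((hdf q.2 q.1 y).const_mul _).fderiv]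
      simp
      ring
    have hfun : ∀ k, fderiv ℝ (fun y => ∫ q, Φ k y q ∂μ) y (stdVec k) =
        ∫ q, fderiv ℝ (fun y => Φ k y q) y (stdVec k) ∂μ := fun k =>
      fderiv_integral_of_compact μ (hΦ k) hK (h0 k) y (stdVec k)
    have hcd : Continuous fun z => fderiv ℝ f z := hf.continuous_fderiv (by simp)
    have hgcont := hg.continuous
    have hχc : Continuous χ := χ.continuous
    have hcont : ∀ k, Continuous fun q : EuclideanSpace ℝ (Fin n) × ℝ =>
        (g (p + q.1) * ((χ q.2 : ℝ) : ℂ)) *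
          (((q.1 k : ℝ) : ℂ) * fderiv ℝ f (y - q.2 • q.1) (stdVec k)) := by
      intro k
      have : Continuous fun q : EuclideanSpace ℝ (Fin n) × ℝ =>
          fderiv ℝ f (y - q.2 • q.1) (stdVec k) :=
        (hcd.comp (by fun_prop)).clm_apply continuous_const
      fun_prop
    have hsupp : ∀ q ∉ K, g (p + q.1) * ((χ q.2 : ℝ) : ℂ) = 0 := by
      intro q hq
      by_cases h1 : q.1 ∈ Metric.closedBall (0 : EuclideanSpace ℝ (Fin n)) r
      · have h2 : q.2 ∉ Metric.closedBall (0 : ℝ) 2 := fun h2 => hq ⟨h1, h2⟩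
        have : χ q.2 = 0 := χ.zero_of_le_dist (not_lt.1 fun h => h2 (Metric.ball_subset_closedBall h))
        simp [this]
      · have : g (p + q.1) = 0 := hg0 _ (by simpa using h1)
        simp [this]
    have hint : ∀ k, Integrable (fun q : EuclideanSpace ℝ (Fin n) × ℝ =>
        (g (p + q.1) * ((χ q.2 : ℝ) : ℂ)) *
          (((q.1 k : ℝ) : ℂ) * fderiv ℝ f (y - q.2 • q.1) (stdVec k))) := fun k =>
      (hcont k).integrable_of_hasCompactSupport
        (HasCompactSupport.intro hK fun q hq => by rw [hsupp q hq, zero_mul])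
    simp only [hfun, hder]
    rw [← integral_finsetSum _ fun k _ => (hint k).restrict]
    simp only [← Finset.mul_sum, sum_apply_stdVec]
    have hint2 : Integrable (fun q : EuclideanSpace ℝ (Fin n) × ℝ =>
        (g (p + q.1) * ((χ q.2 : ℝ) : ℂ)) * fderiv ℝ f (y - q.2 • q.1) q.1) := by
      refine (integrable_finsetSum Finset.univ fun k _ => hint k).congr (.of_forall fun q => ?_)
      simp only [← Finset.mul_sum, sum_apply_stdVec]
    have hprod := setIntegral_prod (μ := (volume : Measure (EuclideanSpace ℝ (Fin n))))
      (ν := (volume : Measure ℝ)) (s := Set.univ) (t := Set.Ioc (0 : ℝ) 1)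
      (fun q : EuclideanSpace ℝ (Fin n) × ℝ =>
        (g (p + q.1) * ((χ q.2 : ℝ) : ℂ)) * fderiv ℝ f (y - q.2 • q.1) q.1)
      (by rw [← Measure.volume_eq_prod]; exact hint2.integrableOn)
    rw [← Measure.volume_eq_prod] at hprod
    rw [hprod, Measure.restrict_univ]
    have hinner : ∀ v : EuclideanSpace ℝ (Fin n), ∫ t in Set.Ioc (0 : ℝ) 1,
        (g (p + v) * ((χ t : ℝ) : ℂ)) * fderiv ℝ f (y - t • v) v =
          g (p + v) * f y - g (p + v) * f (y - v) := by
      intro v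
      have h1 : ∫ t in Set.Ioc (0 : ℝ) 1,
          (g (p + v) * ((χ t : ℝ) : ℂ)) * fderiv ℝ f (y - t • v) v =
          ∫ t in (0 : ℝ)..1, g (p + v) * fderiv ℝ f (y - t • v) v := by
        rw [intervalIntegral.integral_of_le zero_le_one]
        refine setIntegral_congr_fun measurableSet_Ioc fun t ht => ?_
        have : χ t = 1 := χ.one_of_mem_closedBall (by
          rw [mem_closedBall_zero_iff, Real.norm_of_nonneg ht.1.le]; exact ht.2)
        simp [this]
      rw [h1, intervalIntegral.integral_const_mul]
      have hd : ∀ t ∈ Set.uIcc (0 : ℝ) 1, HasDerivAt (fun t : ℝ => -f (y - t • v))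
          (fderiv ℝ f (y - t • v) v) t := by
        intro t _
        have e1 : HasDerivAt (fun t : ℝ => y - t • v) (-v) t := by
          simpa using ((hasDerivAt_id t).smul_const v).const_sub y
        have e2 := ((hf.differentiable (by simp) (y - t • v)).hasFDerivAt).comp_hasDerivAt t e1
        have e3 := e2.neg
        rw [map_neg, neg_neg] at e3
        exact e3
      rw [intervalIntegral.integral_eq_sub_of_hasDerivAt hd
        (((hcd.comp (by fun_prop)).clm_apply continuous_const).intervalIntegrable _ _)]
      simp
      ring
    simp only [hinner]
    have i1 : Integrable fun v => g (p + v) * f y :=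
      ((hgcont.comp (by fun_prop)).integrable_of_hasCompactSupport hgc).mul_const _
    have i2 : Integrable fun v => g (p + v) * f (y - v) :=
      ((hgcont.comp (by fun_prop)).mul (hf.continuous.comp (by fun_prop))
        ).integrable_of_hasCompactSupport hgc.mul_right
    rw [integral_sub i1 i2, integral_mul_const, integral_add_left_eq_self, mul_comm]

/-- A linear functional that kills the partial derivatives of test functions is, on test functions
supported in the ball of half the radius, a multiple of the integral: convolution being
commutative, `f ∫ g - g ∫ f` is a divergence. -/
theorem exists_eq_const_mul_integral (ν : (EuclideanSpace ℝ (Fin n) → ℂ) →ₗ[ℂ] ℂ)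
    (p : EuclideanSpace ℝ (Fin n)) {r : ℝ} (hr : 0 < r)
    (hν : ∀ W : EuclideanSpace ℝ (Fin n) → ℂ, ContDiff ℝ ∞ W →
      tsupport W ⊆ Metric.closedBall p (2 * r) → ∀ k, ν (fun y => fderiv ℝ W y (stdVec k)) = 0) :
    ∃ κ : ℂ, ∀ f : EuclideanSpace ℝ (Fin n) → ℂ, ContDiff ℝ ∞ f →
      tsupport f ⊆ Metric.closedBall p r → ν f = κ * ∫ y, f y := by
  let b : ContDiffBump p := ⟨r / 2, r, half_pos hr, half_lt_self hr⟩
  let g : EuclideanSpace ℝ (Fin n) → ℂ := fun y => (b.normed volume y : ℝ)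
  have hg : ContDiff ℝ ∞ g := Complex.ofRealCLM.contDiff.comp b.contDiff_normed
  have hgs : tsupport g ⊆ Metric.closedBall p r := by
    refine (closure_mono fun y hy => ?_).trans (b.tsupport_normed_eq (μ := volume)).subset
    intro h
    exact hy (by simp [g, h])
  have hgi : ∫ y, g y = 1 := by
    have := b.integral_normed (μ := volume)
    rw [integral_complex_ofReal, this]; simp
  refine ⟨ν g, fun f hf hfs => ?_⟩
  obtain ⟨W, hW, hWs, hWd⟩ := exists_divergence_convolution hf hg hfs hgs
  obtain ⟨W', hW', hWs', hWd'⟩ := exists_divergence_convolution hg hf hgs hfs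
  have hsym : ∀ y, ∫ v, g (p + v) * f (y - v) = ∫ v, f (p + v) * g (y - v) := by
    intro y
    rw [← integral_sub_left_eq_self _ volume (y - p)]
    congr 1
    ext v
    rw [mul_comm]
    congr 2 <;> abel
  have key : f = (∫ y, f y) • g + ∑ k, (fun y => fderiv ℝ (W k) y (stdVec k)) -
      ∑ k, (fun y => fderiv ℝ (W' k) y (stdVec k)) := by
    ext y
    have h1 := hWd y
    have h2 := hWd' y
    rw [hsym y, hgi] at h1
    simp only [Pi.sub_apply, Pi.add_apply, Pi.smul_apply, smul_eq_mul, Finset.sum_apply]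
    linear_combination h1 - h2
  rw [key, map_sub, map_add, map_sum, map_sum, map_smul]
  simp only [hν _ (hW _) (hWs _), hν _ (hW' _) (hWs' _), ← key]
  simp [mul_comm]

end Divergence

/-! ### Derivatives of determinants -/

section Jacobi

variable {V : Type*} [NormedAddCommGroup V] [NormedSpace ℝ V] {n : ℕ}

/-- Jacobi's formula for the derivative of a determinant. -/
theorem hasFDerivAt_det {A : V → Matrix (Fin n) (Fin n) ℝ} {A' : Fin n → Fin n → V →L[ℝ] ℝ} {y : V}
    (hA : ∀ i j, HasFDerivAt (fun z => A z i j) (A' i j) y) :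
    HasFDerivAt (fun z => (A z).det) (∑ i, ∑ j, (A y).adjugate j i • A' i j) y := by
  let D : ContinuousMultilinearMap ℝ (fun _ : Fin n => Fin n → ℝ) ℝ :=
    { (Matrix.detRowAlternating (n := Fin n) (R := ℝ)).toMultilinearMap with
      cont := Continuous.matrix_det (A := fun m : Fin n → Fin n → ℝ => Matrix.of m) continuous_id }
  have h := HasFDerivAt.multilinear_comp (f := D) (g := fun i z => A z i)
    (g' := fun i => ContinuousLinearMap.pi (A' i)) (x := y)
    (fun i => hasFDerivAt_pi.2 fun j => hA i j)
  refine h.congr_fderiv ?_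
  ext v
  simp only [sum_apply, smul_apply,
    ContinuousLinearMap.comp_apply, smul_eq_mul]
  refine Finset.sum_congr rfl fun i _ => ?_
  change ((A y).updateRow i (fun j => A' i j v)).det = _
  rw [← Matrix.cramer_transpose_apply, Matrix.cramer_eq_adjugate_mulVec, ← Matrix.adjugate_transpose,
    Matrix.mulVec, dotProduct]
  rfl

/-- The derivative of `√|det A|`, in terms of a left inverse `P` of `A`. -/
theorem hasFDerivAt_sqrt_abs_det {A : V → Matrix (Fin n) (Fin n) ℝ}
    {A' : Fin n → Fin n → V →L[ℝ] ℝ} {y : V} (hA : ∀ i j, HasFDerivAt (fun z => A z i j) (A' i j) y)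
    {P : Matrix (Fin n) (Fin n) ℝ} (hP : P * A y = 1) :
    HasFDerivAt (fun z => √|(A z).det|)
      ((√|(A y).det| / 2) • ∑ i, ∑ j, P j i • A' i j) y := by
  have hu : (A y).det ≠ 0 := by
    intro h
    have := congrArg Matrix.det hP
    rw [Matrix.det_mul, h, Matrix.det_one] at this
    simp at this
  have hadj : (A y).adjugate = (A y).det • P := by
    have h1 : P * A y * (A y).adjugate = (A y).adjugate := by rw [hP, one_mul]
    rw [← h1, mul_assoc, Matrix.mul_adjugate]
    simp
  have h := ((hasFDerivAt_det hA).abs hu).sqrt (abs_ne_zero.2 hu)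
  refine h.congr_fderiv ?_
  have hs : √|(A y).det| ≠ 0 := (Real.sqrt_pos.2 (abs_pos.2 hu)).ne'
  have hsq : √|(A y).det| * √|(A y).det| = |(A y).det| := Real.mul_self_sqrt (abs_nonneg _)
  have hsign : (SignType.sign (A y).det : ℝ) * (A y).det = |(A y).det| := sign_mul_self _
  ext v
  simp only [sum_apply, smul_apply, smul_eq_mul, hadj,
    Matrix.smul_apply, mul_assoc, ← Finset.mul_sum]
  generalize ∑ i, ∑ j, P j i * A' i j v = s
  field_simp
  rw [pow_two, hsq, ← hsign]

/-- The identity behind Liouville's theorem: for an invertible antisymmetric matrix `A`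
whose derivatives `d k i j = ∂ₖ Aᵢⱼ` satisfy the cocycle identity of a closed form, the divergence
of the inverse is half of a logarithmic derivative of the determinant. -/
theorem sum_inverse_mul_deriv {A P : Matrix (Fin n) (Fin n) ℝ} (hP : P * A = 1)
    (hA : ∀ i j, A i j = -A j i) {d : Fin n → Fin n → Fin n → ℝ}
    (hd : ∀ k i j, d k i j = -d k j i)
    (hc : ∀ i j k, d i j k + d j k i + d k i j = 0) (k : Fin n) :
    ∑ i, ∑ j, P j i * d i k j = (∑ i, ∑ j, P j i * d k i j) / 2 := by
  have hPt : ∀ i j, P i j = -P j i := by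
    have h1 : A.transpose = -A := by ext i j; simp [hA j i]
    have h2 : P.transpose = -P := by
      have h3 : A * P = 1 := mul_eq_one_comm.1 hP
      have h4 : P.transpose * A.transpose = 1 := by rw [← Matrix.transpose_mul, h3]; simp
      rw [h1] at h4
      calc P.transpose = P.transpose * (A * P) := by rw [h3, mul_one]
        _ = -((P.transpose * -A) * P) := by simp [mul_assoc]
        _ = -P := by rw [h4, one_mul]
    intro i j
    have := congrFun (congrFun h2 j) i
    simpa using this
  have h1 : ∑ i, ∑ j, P j i * d i k j = ∑ i, ∑ j, P j i * d j i k := by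
    rw [Finset.sum_comm]
    refine Finset.sum_congr rfl fun i _ => Finset.sum_congr rfl fun j _ => ?_
    rw [hPt, hd j k i]
    ring
  have h2 : ∑ i, ∑ j, P j i * (d i k j + d j i k - d k i j) = 0 := by
    refine Finset.sum_eq_zero fun i _ => Finset.sum_eq_zero fun j _ => ?_
    rw [show d i k j + d j i k - d k i j = 0 by linarith [hc i j k, hd i k j, hd j i k], mul_zero]
  simp only [mul_add, mul_sub, Finset.sum_add_distrib, Finset.sum_sub_distrib] at h2
  linarith

end Jacobi

/-! ### The lowest order of the formal KMS condition -/

section LeadingCoefficient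

variable {n : ℕ} {M : Type*} [TopologicalSpace M] [ChartedSpace (EuclideanSpace ℝ (Fin n)) M]

/-- Smooth functions with compact support, as a subspace of all functions. -/
def testFunctions (n : ℕ) (M : Type*) [TopologicalSpace M]
    [ChartedSpace (EuclideanSpace ℝ (Fin n)) M] : Submodule ℂ (M → ℂ) where
  carrier := {f | ContMDiff (𝓡 n) 𝓘(ℝ, ℂ) ∞ f ∧ HasCompactSupport f}
  add_mem' hf hg := ⟨(smoothFunctions n M).add_mem hf.1 hg.1, hf.2.add hg.2⟩
  zero_mem' := ⟨(smoothFunctions n M).zero_mem, HasCompactSupport.zero⟩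
  smul_mem' c _ hf := ⟨(smoothFunctions n M).smul_mem hf.1 c, hf.2.smul_left (f := fun _ => c)⟩

/-- A test function, as a constant formal series. -/
def constFormal (f : testFunctions n M) : compactFormalFunctions n M :=
  ⟨PowerSeries.C ⟨f.1, f.2.1⟩, fun r => by
    rw [PowerSeries.coeff_C]
    split_ifs
    · exact f.2.2
    · exact HasCompactSupport.zero⟩

theorem coeff_smul_formal (c : ℂ) (F : FormalFunctions n M) (r : ℕ) :
    PowerSeries.coeff r ((PowerSeries.C c : PowerSeries ℂ) • F) = c • PowerSeries.coeff r F := by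
  rw [formal_smul_coeff, Finset.sum_eq_single (0, r)]
  · simp
  · rintro ⟨i, j⟩ hij hne
    have : i ≠ 0 := by
      rintro rfl
      simp at hij
      exact hne (by simp [hij])
    simp [PowerSeries.coeff_C, this]
  · simp

theorem coeff_zero_X_smul (F : FormalFunctions n M) :
    PowerSeries.coeff 0 ((PowerSeries.X : PowerSeries ℂ) • F) = 0 := by
  rw [formal_smul_coeff]
  simp

theorem coeff_succ_X_smul (F : FormalFunctions n M) (r : ℕ) :
    PowerSeries.coeff (r + 1) ((PowerSeries.X : PowerSeries ℂ) • F) = PowerSeries.coeff r F := by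
  rw [formal_smul_coeff, Finset.sum_eq_single (1, r)]
  · simp
  · rintro ⟨i, j⟩ hij hne
    have : i ≠ 1 := by
      rintro rfl
      rw [Finset.HasAntidiagonal.mem_antidiagonal] at hij
      exact hne (by simp; omega)
    simp [PowerSeries.coeff_X, this]
  · intro h
    exact absurd (by rw [Finset.HasAntidiagonal.mem_antidiagonal]; omega) h

/-- The `r`-th coefficient of `μ` on test functions, the functional `μ_r` in `μ = ∑ λʳ μ_r`. -/
def coeffFunctional (μ : compactFormalFunctions n M →ₗ[PowerSeries ℂ] PowerSeries ℂ) (r : ℕ) :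
    testFunctions n M →ₗ[ℂ] ℂ where
  toFun f := PowerSeries.coeff r (μ (constFormal f))
  map_add' f g := by
    rw [← map_add, ← map_add]
    congr 2
    refine Subtype.ext ?_
    change PowerSeries.C (⟨f.1, f.2.1⟩ + ⟨g.1, g.2.1⟩ : smoothFunctions n M) = _
    rw [map_add]
    rfl
  map_smul' c f := by
    have h : constFormal (c • f) = (PowerSeries.C c : PowerSeries ℂ) • constFormal f := by
      refine Subtype.ext (PowerSeries.ext fun m => ?_)
      change _ = PowerSeries.coeff m ((PowerSeries.C c : PowerSeries ℂ) • (constFormal f).1)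
      rw [coeff_smul_formal]
      simp only [constFormal, PowerSeries.coeff_C]
      split_ifs
      · rfl
      · simp
    rw [h, map_smul]
    simp

/-- The coefficients of a formal series of compactly supported functions, as test functions. -/
def coeffTest (F : compactFormalFunctions n M) (j : ℕ) : testFunctions n M :=
  ⟨(PowerSeries.coeff j F.1 : smoothFunctions n M).1,
    (PowerSeries.coeff j F.1 : smoothFunctions n M).2, F.2 j⟩

/-- The quotient of `F - F₀` by `λ`. -/
def shiftFormal (F : compactFormalFunctions n M) : compactFormalFunctions n M :=
  ⟨PowerSeries.mk fun r => PowerSeries.coeff (r + 1) F.1, fun r => by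
    rw [PowerSeries.coeff_mk]; exact F.2 (r + 1)⟩

theorem eq_const_add_X_smul_shift (F : compactFormalFunctions n M) :
    F = constFormal (coeffTest F 0) + (PowerSeries.X : PowerSeries ℂ) • shiftFormal F := by
  refine Subtype.ext (PowerSeries.ext fun m => ?_)
  change _ = PowerSeries.coeff m
    ((constFormal (coeffTest F 0)).1 + (PowerSeries.X : PowerSeries ℂ) • (shiftFormal F).1)
  rw [map_add]
  rcases m with _ | m
  · rw [coeff_zero_X_smul, add_zero]
    simp only [constFormal, PowerSeries.coeff_C]
    rfl
  · rw [coeff_succ_X_smul]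
    simp [constFormal, shiftFormal]

/-- A `ℂ[[λ]]`-linear functional is determined by its values on test functions:
`μ(F)_m = ∑_{i + j = m} μ_i(F_j)`. -/
theorem coeff_apply_eq_sum (μ : compactFormalFunctions n M →ₗ[PowerSeries ℂ] PowerSeries ℂ)
    (m : ℕ) (F : compactFormalFunctions n M) :
    PowerSeries.coeff m (μ F) = ∑ p ∈ Finset.HasAntidiagonal.antidiagonal m,
      coeffFunctional μ p.1 (coeffTest F p.2) := by
  induction m generalizing F with
  | zero =>
    conv_lhs => rw [eq_const_add_X_smul_shift F]
    simp [coeffFunctional]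
  | succ m ih =>
    conv_lhs => rw [eq_const_add_X_smul_shift F]
    rw [map_add, map_smul, smul_eq_mul, map_add, PowerSeries.coeff_succ_X_mul, ih,
      Finset.Nat.antidiagonal_succ', Finset.sum_cons, Finset.sum_map]
    congr 1
    refine Finset.sum_congr rfl fun p _ => ?_
    simp [coeffTest, shiftFormal]

theorem alternating_pair_swap {V : Type*} [NormedAddCommGroup V] [NormedSpace ℝ V]
    (η : V [⋀^Fin 2]→L[ℝ] ℝ) (v w : V) : η ![v, w] = -η ![w, v] := by
  have e : ![v, w] = ![w, v] ∘ Equiv.swap 0 1 := by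
    ext1 i; fin_cases i <;> rfl
  rw [e]
  exact η.toAlternatingMap.map_swap ![w, v] (by simp)

/-- `{H, f} = -df(X)` for a local Hamiltonian `H` of `X`. -/
theorem poisson_apply_hamiltonian [IsManifold (𝓡 n) ∞ M] {σ : SymplecticForm n M}
    (X : SymplecticVectorField σ) {x : M} {H : M → ℝ} (hH : IsLocalHamiltonian X x H)
    (f : M → ℂ) :
    σ.poisson (ofRealSmooth H hH.1 : smoothFunctions n M) f x =
      -complexDifferential f x (X.field x) := by
  have hα : ∀ v : TangentSpace (𝓡 n) x, σ.form x ![X.field x, v] = mfderiv (𝓡 n) 𝓘(ℝ, ℝ) H x v := by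
    intro v
    have h := hH.2.self_of_nhds
    have h1 := interior₂_apply σ.form X.field x ![v]
    rw [h] at h1
    exact h1.symm
  have hd : ∀ v : TangentSpace (𝓡 n) x,
      complexDifferential (ofRealSmooth H hH.1 : smoothFunctions n M).1 x v =
        ((σ.form x ![X.field x, v] : ℝ) : ℂ) := by
    intro v
    rw [hα]
    have h1 : HasMFDerivAt 𝓘(ℝ, ℝ) 𝓘(ℝ, ℂ) Complex.ofReal (H x) Complex.ofRealCLM :=
      Complex.ofRealCLM.hasFDerivAt.hasMFDerivAt
    have h2 := ((hH.1 x).mdifferentiableAt (by simp)).hasMFDerivAt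
    have h3 := (h1.comp x h2).mfderiv
    change mfderiv (𝓡 n) 𝓘(ℝ, ℂ) (Complex.ofReal ∘ H) x v = _
    rw [h3]
    rfl
  have hanti : ∀ v w : TangentSpace (𝓡 n) x, σ.form x ![v, w] = -σ.form x ![w, v] :=
    fun v w => alternating_pair_swap (V := EuclideanSpace ℝ (Fin n)) (σ.form x) v w
  unfold SymplecticForm.poisson
  rw [hd, hd, hanti, hanti (X.field x), σ.hamiltonianVector_spec, σ.hamiltonianVector_spec]
  change ((-(complexDifferential f x (X.field x)).re : ℝ) : ℂ) +
    Complex.I * ((-(complexDifferential f x (X.field x)).im : ℝ) : ℂ) = _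
  conv_rhs => rw [← Complex.re_add_im (complexDifferential f x (X.field x))]
  push_cast
  ring

/-- Antisymmetry of the Poisson bracket, read off from its expression through `M₁`. -/
theorem poisson_antisymm {σ : SymplecticForm n M} (S : StarProduct σ) (f g : smoothFunctions n M) :
    σ.poisson f g = -σ.poisson (g : M → ℂ) f := by
  ext x
  have h1 := S.op_one f g x
  have h2 := S.op_one g f x
  have : Complex.I * (σ.poisson f g x + σ.poisson (g : M → ℂ) f x) = 0 := by
    linear_combination -h1 - h2
  have := (mul_eq_zero.1 this).resolve_left Complex.I_ne_zero
  rw [Pi.neg_apply]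
  linear_combination this

theorem coeff_one_mul {σ : SymplecticForm n M} (S : StarProduct σ) (F G : FormalFunctions n M) :
    PowerSeries.coeff 1 (S.mul F G) =
      PowerSeries.coeff 0 F * PowerSeries.coeff 1 G + PowerSeries.coeff 1 F * PowerSeries.coeff 0 G +
        S.op 1 (PowerSeries.coeff 0 F) (PowerSeries.coeff 0 G) := by
  rw [StarProduct.mul, formalProduct, PowerSeries.coeff_mk]
  simp [Finset.Nat.antidiagonal_succ, S.op_zero]

theorem coeff_zero_mul {σ : SymplecticForm n M} (S : StarProduct σ) (F G : FormalFunctions n M) :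
    PowerSeries.coeff 0 (S.mul F G) = PowerSeries.coeff 0 F * PowerSeries.coeff 0 G := by
  rw [StarProduct.mul, formalProduct, PowerSeries.coeff_mk]
  simp [S.op_zero]

/-- The first order of `δ_X` is the derivation `-i X`. -/
theorem coeff_one_delta_C [IsManifold (𝓡 n) ∞ M] [T2Space M] {σ : SymplecticForm n M}
    (S : StarProduct σ) (X : SymplecticVectorField σ) (f : smoothFunctions n M) (x : M) :
    (PowerSeries.coeff 1 (delta S X (PowerSeries.C f)) : smoothFunctions n M).1 x =
      -(Complex.I * complexDifferential f.1 x (X.field x)) := by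
  have hx := X.localHamiltonian_spec x
  rw [delta_eq_ad S X _ 1 hx, coeff_ad]
  have h := S.op_one (ofRealSmooth _ hx.1) f x
  rw [poisson_apply_hamiltonian X hx] at h
  simp only [Finset.Nat.antidiagonal_succ, Finset.Nat.antidiagonal_zero, Finset.map_singleton,
    Finset.sum_cons, Finset.sum_singleton]
  simp [PowerSeries.coeff_C, S.op_zero]
  simpa using h

/-- The lowest nonvanishing coefficient of a nonzero formal KMS functional satisfies the classical
KMS condition. It is extended arbitrarily to a linear functional on all functions `M → ℂ`, so that
no membership proofs have to be carried along. -/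
theorem exists_classical_KMS [IsManifold (𝓡 n) ∞ M] [T2Space M] {σ : SymplecticForm n M}
    (S : StarProduct σ) (X : SymplecticVectorField σ) (β : ℝ)
    (μ : compactFormalFunctions n M →ₗ[PowerSeries ℂ] PowerSeries ℂ)
    (hμ : IsStaticKMS S X β μ) (hne : μ ≠ 0) :
    ∃ T : (M → ℂ) →ₗ[ℂ] ℂ, (∃ f ∈ testFunctions n M, T f ≠ 0) ∧
      ∀ f ∈ testFunctions n M, ∀ g ∈ testFunctions n M, T (σ.poisson f g) =
        β * T (fun x => f x * complexDifferential g x (X.field x)) := by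
  have hex : ∃ r, coeffFunctional μ r ≠ 0 := by
    by_contra! h
    refine hne (LinearMap.ext fun F => PowerSeries.ext fun m => ?_)
    rw [coeff_apply_eq_sum]
    simp [h]
  classical
  let k := Nat.find hex
  have hk : coeffFunctional μ k ≠ 0 := Nat.find_spec hex
  have hlt : ∀ r < k, coeffFunctional μ r = 0 := fun r hr => not_not.1 (Nat.find_min hex hr)
  obtain ⟨T, hT⟩ := LinearMap.exists_extend (coeffFunctional μ k)
  have hTa : ∀ f : testFunctions n M, T f.1 = coeffFunctional μ k f := fun f =>
    LinearMap.congr_fun hT f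
  -- Only the two lowest coefficients of `F` enter the coefficient `k + 1` of `μ F`.
  have hkF : ∀ F : compactFormalFunctions n M, PowerSeries.coeff (k + 1) (μ F) =
      coeffFunctional μ (k + 1) (coeffTest F 0) + T (coeffTest F 1).1 := by
    intro F
    rw [coeff_apply_eq_sum, hTa, Finset.Nat.sum_antidiagonal_succ', Finset.sum_eq_single (k, 0)]
    · rintro ⟨i, j⟩ hij hne'
      have : i < k := by
        simp only [Finset.HasAntidiagonal.mem_antidiagonal] at hij
        refine lt_of_le_of_ne (by omega) ?_
        rintro rfl
        exact hne' (by simp; omega)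
      simp [hlt i this]
    · intro h; simp at h
  refine ⟨T, ?_, ?_⟩
  · by_contra! h
    exact hk (LinearMap.ext fun f => by rw [← hTa, h f.1 f.2]; rfl)
  have main : ∀ f ∈ testFunctions n M, ∀ g ∈ testFunctions n M, T (σ.poisson f g) =
        -β * T (fun x => g x * complexDifferential f x (X.field x)) := by
    intro f hf g hg
    let f' : smoothFunctions n M := ⟨f, hf.1⟩
    let g' : smoothFunctions n M := ⟨g, hg.1⟩
    have h := congrArg (PowerSeries.coeff (k + 1))
      (hμ (constFormal ⟨f, hf⟩) (constFormal ⟨g, hg⟩))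
    rw [hkF, hkF] at h
    have e0 : coeffTest ⟨S.mul (constFormal ⟨f, hf⟩) (constFormal ⟨g, hg⟩),
        S.mul_mem_compact (constFormal ⟨f, hf⟩).2 _⟩ 0 =
      coeffTest ⟨S.mul (constFormal ⟨g, hg⟩) (expDelta S X β (constFormal ⟨f, hf⟩)),
        S.mul_mem_compact (constFormal ⟨g, hg⟩).2 _⟩ 0 := by
      refine Subtype.ext ?_
      simp only [coeffTest]
      rw [coeff_zero_mul, coeff_zero_mul]
      simp [expDelta, constFormal, mul_comm]
    rw [e0] at h
    have h' := add_left_cancel h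
    have e1 : (coeffTest ⟨S.mul (constFormal ⟨f, hf⟩) (constFormal ⟨g, hg⟩),
        S.mul_mem_compact (constFormal ⟨f, hf⟩).2 _⟩ 1).1 = (S.op 1 f' g').1 := by
      simp only [coeffTest]
      rw [coeff_one_mul]
      simp [constFormal, f', g']
    have e2 : (coeffTest ⟨S.mul (constFormal ⟨g, hg⟩) (expDelta S X β (constFormal ⟨f, hf⟩)),
        S.mul_mem_compact (constFormal ⟨g, hg⟩).2 _⟩ 1).1 = (S.op 1 g' f').1 +
          (-(β * Complex.I)) • fun x => g x * complexDifferential f x (X.field x) := by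
      simp only [coeffTest]
      rw [coeff_one_mul]
      ext x
      have hd := coeff_one_delta_C S X f' x
      simp [constFormal, f', g', expDelta, Finset.sum_range_succ] at hd ⊢
      rw [hd]
      ring
    have e3 : Complex.I • σ.poisson f g = (S.op 1 f' g').1 - (S.op 1 g' f').1 := by
      ext x
      exact (S.op_one f' g' x).symm
    rw [e1, e2, map_add, map_smul] at h'
    have h4 := congrArg T e3
    rw [map_sub, map_smul, h'] at h4
    simp only [smul_eq_mul] at h4
    have : Complex.I * (T (σ.poisson f g) +
        β * T (fun x => g x * complexDifferential f x (X.field x))) = 0 := by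
      linear_combination h4
    have := (mul_eq_zero.1 this).resolve_left Complex.I_ne_zero
    linear_combination this
  intro f hf g hg
  rw [show σ.poisson f g = -σ.poisson g f from poisson_antisymm S ⟨f, hf.1⟩ ⟨g, hg.1⟩, map_neg,
    main g hg f hf]
  ring

end LeadingCoefficient

/-! ### Symplectic forms in a chart -/

section ChartMatrix

variable {n : ℕ} {M : Type*} [TopologicalSpace M] [ChartedSpace (EuclideanSpace ℝ (Fin n)) M]

/-- An alternating `2`-form as a bilinear map. -/
def altBilin {V : Type*} [NormedAddCommGroup V] [NormedSpace ℝ V] (η : V [⋀^Fin 2]→L[ℝ] ℝ) :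
    V →ₗ[ℝ] V →ₗ[ℝ] ℝ :=
  LinearMap.mk₂ ℝ (fun v w : V => (η ![v, w] : ℝ))
    (fun v v' w => by
      have h := η.map_update_add ![0, w] 0 v v'
      rwa [update_pair_zero, update_pair_zero, update_pair_zero] at h)
    (fun a v w => by
      have h := η.map_update_smul ![0, w] 0 a v
      rwa [update_pair_zero, update_pair_zero] at h)
    (fun v w w' => by
      have h := η.map_update_add ![v, 0] 1 w w'
      rwa [update_pair_one, update_pair_one, update_pair_one] at h)
    (fun a v w => by
      have h := η.map_update_smul ![v, 0] 1 a w
      rwa [update_pair_one, update_pair_one] at h)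

theorem altBilin_apply {V : Type*} [NormedAddCommGroup V] [NormedSpace ℝ V]
    (η : V [⋀^Fin 2]→L[ℝ] ℝ) (v w : V) : altBilin η v w = η ![v, w] := rfl

/-- The matrix of a `2`-form on `ℝⁿ` in the standard basis. -/
def formMatrix (η : EuclideanSpace ℝ (Fin n) [⋀^Fin 2]→L[ℝ] ℝ) : Matrix (Fin n) (Fin n) ℝ :=
  Matrix.of fun i j => η ![stdVec i, stdVec j]

theorem sum_smul_stdVec (v : EuclideanSpace ℝ (Fin n)) : ∑ k, v k • stdVec k = v := by
  simpa using (EuclideanSpace.basisFun (Fin n) ℝ).sum_repr v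

theorem apply_pair_right (η : EuclideanSpace ℝ (Fin n) [⋀^Fin 2]→L[ℝ] ℝ)
    (v w : EuclideanSpace ℝ (Fin n)) : η ![v, w] = ∑ j, w j * η ![v, stdVec j] := by
  conv_lhs => rw [← altBilin_apply, ← sum_smul_stdVec w, map_sum]
  simp [altBilin_apply]

theorem apply_pair_left (η : EuclideanSpace ℝ (Fin n) [⋀^Fin 2]→L[ℝ] ℝ)
    (v w : EuclideanSpace ℝ (Fin n)) : η ![v, w] = ∑ i, v i * η ![stdVec i, w] := by
  conv_lhs => rw [← altBilin_apply, ← sum_smul_stdVec v, map_sum, LinearMap.sum_apply]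
  simp [altBilin_apply]

theorem det_formMatrix_comp (η : EuclideanSpace ℝ (Fin n) [⋀^Fin 2]→L[ℝ] ℝ)
    (L : EuclideanSpace ℝ (Fin n) →L[ℝ] EuclideanSpace ℝ (Fin n)) :
    (formMatrix (η.compContinuousLinearMap L)).det = L.det ^ 2 * (formMatrix η).det := by
  let J : Matrix (Fin n) (Fin n) ℝ := Matrix.of fun i j => L (stdVec j) i
  have h1 : formMatrix (η.compContinuousLinearMap L) = J.transpose * formMatrix η * J := by
    ext i j
    have : formMatrix (η.compContinuousLinearMap L) i j = η ![L (stdVec i), L (stdVec j)] := by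
      simp only [formMatrix, Matrix.of_apply, ContinuousAlternatingMap.compContinuousLinearMap_apply]
      congr 1
      ext1 l; fin_cases l <;> rfl
    rw [this, apply_pair_right]
    simp only [Matrix.mul_apply, Matrix.transpose_apply]
    refine Finset.sum_congr rfl fun l _ => ?_
    rw [apply_pair_left, mul_comm]
    rfl
  have h2 : J.det = L.det := by
    have : J = LinearMap.toMatrix (EuclideanSpace.basisFun (Fin n) ℝ).toBasis
        (EuclideanSpace.basisFun (Fin n) ℝ).toBasis L.toLinearMap := by
      ext i j
      simp [J, LinearMap.toMatrix_apply]
    rw [this, LinearMap.det_toMatrix]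
  rw [h1, Matrix.det_mul, Matrix.det_mul, Matrix.det_transpose, h2]
  ring

/-- The matrix of a symplectic form in the preferred chart at `c`. -/
def SymplecticForm.chartMatrix (σ : SymplecticForm n M) (c : M) (y : EuclideanSpace ℝ (Fin n)) :
    Matrix (Fin n) (Fin n) ℝ :=
  formMatrix (chartForm σ.form c y)

theorem SymplecticForm.contDiffOn_chartMatrix (σ : SymplecticForm n M) (c : M) (i j : Fin n) :
    ContDiffOn ℝ ∞ (fun y => σ.chartMatrix c y i j)
      (chartAt (EuclideanSpace ℝ (Fin n)) c).target :=
  (ContinuousAlternatingMap.apply ℝ (EuclideanSpace ℝ (Fin n)) ℝ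
    ![stdVec i, stdVec j]).contDiff.comp_contDiffOn (σ.smooth c)

theorem SymplecticForm.chartMatrix_antisymm (σ : SymplecticForm n M) (c : M)
    (y : EuclideanSpace ℝ (Fin n)) (i j : Fin n) :
    σ.chartMatrix c y i j = -σ.chartMatrix c y j i :=
  alternating_pair_swap (chartForm σ.form c y) (stdVec i) (stdVec j)

/-- `dσ = 0` in coordinates. -/
theorem SymplecticForm.chartMatrix_cocycle (σ : SymplecticForm n M) (c : M)
    {y : EuclideanSpace ℝ (Fin n)} (hy : y ∈ (chartAt (EuclideanSpace ℝ (Fin n)) c).target)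
    (i j k : Fin n) :
    fderiv ℝ (fun y => σ.chartMatrix c y j k) y (stdVec i) +
      fderiv ℝ (fun y => σ.chartMatrix c y k i) y (stdVec j) +
      fderiv ℝ (fun y => σ.chartMatrix c y i j) y (stdVec k) = 0 := by
  have hd : DifferentiableAt ℝ (chartForm σ.form c) y :=
    ((σ.smooth c).contDiffAt
      ((chartAt (EuclideanSpace ℝ (Fin n)) c).open_target.mem_nhds hy)).differentiableAt (by simp)
  have h := extDeriv_apply hd ![stdVec i, stdVec j, stdVec k]
  rw [σ.closed c y hy, Fin.sum_univ_three] at h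
  have e0 : ∀ z, chartForm σ.form c z (Fin.removeNth 0 ![stdVec i, stdVec j, stdVec k]) =
      σ.chartMatrix c z j k := fun z => by
    simp only [SymplecticForm.chartMatrix, formMatrix, Matrix.of_apply]
    congr 1
  have e1 : ∀ z, chartForm σ.form c z (Fin.removeNth 1 ![stdVec i, stdVec j, stdVec k]) =
      σ.chartMatrix c z i k := fun z => by
    simp only [SymplecticForm.chartMatrix, formMatrix, Matrix.of_apply]
    congr 1
    ext1 l; fin_cases l <;> rfl
  have e2 : ∀ z, chartForm σ.form c z (Fin.removeNth 2 ![stdVec i, stdVec j, stdVec k]) =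
      σ.chartMatrix c z i j := fun z => by
    simp only [SymplecticForm.chartMatrix, formMatrix, Matrix.of_apply]
    congr 1
    ext1 l; fin_cases l <;> rfl
  have e3 : (fun z => σ.chartMatrix c z i k) = fun z => -σ.chartMatrix c z k i :=
    funext fun z => σ.chartMatrix_antisymm c z i k
  simp only [e0, e1, e2, e3, fderiv_fun_neg] at h
  simp at h
  linarith


/-- The differential at `x` of the preferred chart at `c`, with values in `ℝⁿ`. -/
def chartDiff (c x : M) : TangentSpace (𝓡 n) x →L[ℝ] EuclideanSpace ℝ (Fin n) :=
  mfderiv (𝓡 n) (𝓡 n) (chartAt (EuclideanSpace ℝ (Fin n)) c) x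

theorem chart_mdifferentiable [IsManifold (𝓡 n) ∞ M] (c : M) :
    (chartAt (EuclideanSpace ℝ (Fin n)) c).MDifferentiable (𝓡 n) (𝓡 n) :=
  have : IsManifold (𝓡 n) 1 M := IsManifold.of_le (n := ∞) (by simp)
  mdifferentiable_chart c

theorem chartDiff_surjective [IsManifold (𝓡 n) ∞ M] (c : M) {x : M}
    (hx : x ∈ (chartAt (EuclideanSpace ℝ (Fin n)) c).source) :
    Function.Surjective (chartDiff (n := n) c x) :=
  ((chart_mdifferentiable c).mfderiv hx).surjective

/-- The local representative of `σ` evaluated on the images of tangent vectors. -/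
theorem SymplecticForm.chartForm_chartDiff [IsManifold (𝓡 n) ∞ M] (σ : SymplecticForm n M) (c : M)
    {x : M} (hx : x ∈ (chartAt (EuclideanSpace ℝ (Fin n)) c).source) (v w : TangentSpace (𝓡 n) x) :
    chartForm σ.form c (chartAt (EuclideanSpace ℝ (Fin n)) c x)
      ![chartDiff c x v, chartDiff c x w] = σ.form x ![v, w] := by
  set φ := chartAt (EuclideanSpace ℝ (Fin n)) c
  have h6 : ∀ w, mfderiv (𝓡 n) (𝓡 n) φ.symm (φ x) (mfderiv (𝓡 n) (𝓡 n) φ x w) = w := fun w =>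
    DFunLike.congr_fun ((chart_mdifferentiable c).symm_comp_deriv hx) w
  let G : M → (Fin 2 → EuclideanSpace ℝ (Fin n)) → ℝ := fun z u => σ.form z u
  change G (φ.symm (φ x)) (fun i => mfderiv (𝓡 n) (𝓡 n) φ.symm (φ x)
    ((![chartDiff c x v, chartDiff c x w] : Fin 2 → EuclideanSpace ℝ (Fin n)) i)) = G x ![v, w]
  rw [φ.left_inv hx]
  congr 1
  ext1 i
  fin_cases i
  · exact h6 v
  · exact h6 w

theorem SymplecticForm.chartMatrix_det_ne_zero [IsManifold (𝓡 n) ∞ M] (σ : SymplecticForm n M)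
    (c : M) {y : EuclideanSpace ℝ (Fin n)}
    (hy : y ∈ (chartAt (EuclideanSpace ℝ (Fin n)) c).target) : (σ.chartMatrix c y).det ≠ 0 := by
  intro h
  obtain ⟨x, hx, rfl⟩ : ∃ x ∈ (chartAt (EuclideanSpace ℝ (Fin n)) c).source,
      chartAt (EuclideanSpace ℝ (Fin n)) c x = y := ⟨_, OpenPartialHomeomorph.map_target _ hy,
    OpenPartialHomeomorph.right_inv _ hy⟩
  obtain ⟨u, hu0, hu⟩ := Matrix.exists_vecMul_eq_zero_iff.2 h
  obtain ⟨v, hv⟩ := chartDiff_surjective c hx (WithLp.toLp 2 u)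
  have hv0 := σ.nondegenerate x v fun w => by
    rw [← σ.chartForm_chartDiff c hx, apply_pair_right, hv]
    refine Finset.sum_eq_zero fun j _ => ?_
    rw [apply_pair_left]
    exact mul_eq_zero_of_right _ (congrFun hu j)
  rw [hv0, map_zero] at hv
  exact hu0 (congrArg WithLp.ofLp hv.symm)

/-- The bracket with a coordinate function: `{f, y_j} = ∑ᵢ (ω⁻¹)_{ji} ∂_i f`. -/
theorem SymplecticForm.poisson_coordinate [IsManifold (𝓡 n) ∞ M] (σ : SymplecticForm n M)
    (c : M) {x : M} (hx : x ∈ (chartAt (EuclideanSpace ℝ (Fin n)) c).source)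
    {P : Matrix (Fin n) (Fin n) ℝ}
    (hP : P * σ.chartMatrix c (chartAt (EuclideanSpace ℝ (Fin n)) c x) = 1)
    {f g : M → ℂ} {j : Fin n} {L : EuclideanSpace ℝ (Fin n) →L[ℝ] ℂ}
    (hf : ∀ v, complexDifferential f x v = L (chartDiff c x v))
    (hg : ∀ v, complexDifferential g x v = ((chartDiff c x v j : ℝ) : ℂ)) :
    σ.poisson f g x = ∑ i, ((P j i : ℝ) : ℂ) * L (stdVec i) := by
  have him : σ.hamiltonianVector x (Complex.imCLM.comp (complexDifferential g x)) = 0 := by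
    refine σ.nondegenerate x _ fun w => ?_
    rw [σ.hamiltonianVector_spec]
    change (complexDifferential g x w).im = 0
    rw [hg, Complex.ofReal_im]
  set v := σ.hamiltonianVector x (Complex.reCLM.comp (complexDifferential g x)) with hv
  have hVu : ∀ u : EuclideanSpace ℝ (Fin n),
      chartForm σ.form c (chartAt (EuclideanSpace ℝ (Fin n)) c x) ![chartDiff c x v, u] = u j := by
    intro u
    obtain ⟨w, rfl⟩ := chartDiff_surjective c hx u
    rw [σ.chartForm_chartDiff c hx, hv, σ.hamiltonianVector_spec]
    change (complexDifferential g x w).re = _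
    rw [hg, Complex.ofReal_re]
  set V := chartDiff c x v
  have hVP : ∀ i, V i = P j i := by
    have h1 : Matrix.vecMul V.ofLp
        (σ.chartMatrix c (chartAt (EuclideanSpace ℝ (Fin n)) c x)) = Pi.single j 1 := by
      ext l
      have := hVu (stdVec l)
      rw [apply_pair_left] at this
      refine this.trans ?_
      simp [Pi.single_apply, eq_comm]
    have h2 := mul_eq_one_comm.1 hP
    have h3 := congrArg (fun z => Matrix.vecMul z P) h1
    simp only [Matrix.vecMul_vecMul, h2, Matrix.vecMul_one] at h3
    intro i
    have := congrFun h3 i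
    simpa using this
  unfold SymplecticForm.poisson
  rw [him, map_zero, mul_zero, add_zero, hf]
  change L V = _
  rw [← sum_apply_stdVec L V]
  simp only [hVP]

/-- The density `|det ω|^{1/2}` of the Liouville volume in the preferred chart at `c`. -/
def SymplecticForm.density (σ : SymplecticForm n M) (c : M) (y : EuclideanSpace ℝ (Fin n)) : ℝ :=
  √|(σ.chartMatrix c y).det|

theorem SymplecticForm.density_pos [IsManifold (𝓡 n) ∞ M] (σ : SymplecticForm n M)
    (c : M) {y : EuclideanSpace ℝ (Fin n)}
    (hy : y ∈ (chartAt (EuclideanSpace ℝ (Fin n)) c).target) : 0 < σ.density c y :=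
  Real.sqrt_pos.2 (abs_pos.2 (σ.chartMatrix_det_ne_zero c hy))

theorem SymplecticForm.contDiffOn_density [IsManifold (𝓡 n) ∞ M] (σ : SymplecticForm n M)
    (c : M) : ContDiffOn ℝ ∞ (σ.density c) (chartAt (EuclideanSpace ℝ (Fin n)) c).target := by
  have h1 : ContDiffOn ℝ ∞ (fun y => (σ.chartMatrix c y).det)
      (chartAt (EuclideanSpace ℝ (Fin n)) c).target := by
    simp only [Matrix.det_apply']
    exact ContDiffOn.sum fun p _ => contDiffOn_const.mul
      (contDiffOn_prod fun i _ => σ.contDiffOn_chartMatrix c _ _)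
  intro y hy
  have hne := σ.chartMatrix_det_ne_zero c hy
  have h2 : ContDiffWithinAt ℝ ∞ (fun y => |(σ.chartMatrix c y).det|)
      (chartAt (EuclideanSpace ℝ (Fin n)) c).target y :=
    (h1 y hy).abs hne
  exact h2.sqrt (abs_ne_zero.2 hne)

/-- The divergence of the inverse matrix of a symplectic form is the logarithmic derivative of the
Liouville density. -/
theorem SymplecticForm.fderiv_density [IsManifold (𝓡 n) ∞ M] (σ : SymplecticForm n M)
    (c : M) {y : EuclideanSpace ℝ (Fin n)}
    (hy : y ∈ (chartAt (EuclideanSpace ℝ (Fin n)) c).target) {P : Matrix (Fin n) (Fin n) ℝ}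
    (hP : P * σ.chartMatrix c y = 1) (k : Fin n) :
    fderiv ℝ (σ.density c) y (stdVec k) = σ.density c y *
      ∑ i, ∑ j, P j i * fderiv ℝ (fun y => σ.chartMatrix c y k j) y (stdVec i) := by
  have hd : ∀ i j, DifferentiableAt ℝ (fun y => σ.chartMatrix c y i j) y := fun i j =>
    ((σ.contDiffOn_chartMatrix c i j).contDiffAt
      ((chartAt (EuclideanSpace ℝ (Fin n)) c).open_target.mem_nhds hy)).differentiableAt (by simp)
  have h1 := (hasFDerivAt_sqrt_abs_det (fun i j => (hd i j).hasFDerivAt) hP).fderiv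
  have h2 := sum_inverse_mul_deriv hP (σ.chartMatrix_antisymm c y)
    (d := fun k i j => fderiv ℝ (fun y => σ.chartMatrix c y i j) y (stdVec k))
    (fun k i j => by
      have : (fun y => σ.chartMatrix c y i j) = fun y => -σ.chartMatrix c y j i :=
        funext fun y => σ.chartMatrix_antisymm c y i j
      rw [this, fderiv_fun_neg]
      rfl)
    (fun i j k => σ.chartMatrix_cocycle c hy i j k) k
  change fderiv ℝ (fun z => √|(σ.chartMatrix c z).det|) y (stdVec k) = _
  rw [h1, h2]
  simp only [sum_apply, smul_apply, smul_eq_mul]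
  unfold SymplecticForm.density
  ring

end ChartMatrix

/-! ### The classical KMS condition in a chart -/

section LocalKMS

variable {n : ℕ} {M : Type*} [TopologicalSpace M] [ChartedSpace (EuclideanSpace ℝ (Fin n)) M]

/-- The function on `M` given by `G` in the preferred chart at `c`, extended by zero outside the
domain of the chart. -/
def pullChart (c : M) : (EuclideanSpace ℝ (Fin n) → ℂ) →ₗ[ℂ] (M → ℂ) where
  toFun G := (chartAt (EuclideanSpace ℝ (Fin n)) c).source.indicator
    (G ∘ chartAt (EuclideanSpace ℝ (Fin n)) c)
  map_add' _ _ := Set.indicator_add _ _ _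
  map_smul' a G := Set.indicator_const_smul _ a (G ∘ chartAt (EuclideanSpace ℝ (Fin n)) c)

theorem pullChart_of_mem {c x : M} (hx : x ∈ (chartAt (EuclideanSpace ℝ (Fin n)) c).source)
    (G : EuclideanSpace ℝ (Fin n) → ℂ) :
    pullChart c G x = G (chartAt (EuclideanSpace ℝ (Fin n)) c x) :=
  Set.indicator_of_mem hx (G ∘ chartAt (EuclideanSpace ℝ (Fin n)) c)

theorem pullChart_of_notMem_image {c x : M} {K : Set (EuclideanSpace ℝ (Fin n))}
    (hx : x ∉ (chartAt (EuclideanSpace ℝ (Fin n)) c).symm '' K)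
    {G : EuclideanSpace ℝ (Fin n) → ℂ} (hG : ∀ y ∉ K, G y = 0) : pullChart c G x = 0 := by
  by_cases h : x ∈ (chartAt (EuclideanSpace ℝ (Fin n)) c).source
  · rw [pullChart_of_mem h]
    exact hG _ fun hK => hx ⟨_, hK, OpenPartialHomeomorph.left_inv _ h⟩
  · exact Set.indicator_of_notMem h (G ∘ chartAt (EuclideanSpace ℝ (Fin n)) c)

theorem isCompact_chart_symm_image {c : M} {K : Set (EuclideanSpace ℝ (Fin n))} (hK : IsCompact K)
    (hKt : K ⊆ (chartAt (EuclideanSpace ℝ (Fin n)) c).target) :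
    IsCompact ((chartAt (EuclideanSpace ℝ (Fin n)) c).symm '' K) :=
  hK.image_of_continuousOn ((chartAt (EuclideanSpace ℝ (Fin n)) c).continuousOn_symm.mono hKt)

theorem tsupport_pullChart_subset [T2Space M] {c : M} {K : Set (EuclideanSpace ℝ (Fin n))}
    (hK : IsCompact K) (hKt : K ⊆ (chartAt (EuclideanSpace ℝ (Fin n)) c).target)
    {G : EuclideanSpace ℝ (Fin n) → ℂ} (hG : ∀ y ∉ K, G y = 0) :
    tsupport (pullChart c G) ⊆ (chartAt (EuclideanSpace ℝ (Fin n)) c).symm '' K := by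
  refine closure_minimal (fun x hx => ?_) (isCompact_chart_symm_image hK hKt).isClosed
  by_contra h
  exact hx (pullChart_of_notMem_image h hG)

theorem pullChart_mem_testFunctions [IsManifold (𝓡 n) ∞ M] [T2Space M] {c : M}
    {K : Set (EuclideanSpace ℝ (Fin n))}
    (hK : IsCompact K) (hKt : K ⊆ (chartAt (EuclideanSpace ℝ (Fin n)) c).target)
    {G : EuclideanSpace ℝ (Fin n) → ℂ} (hGs : ContDiff ℝ ∞ G) (hG : ∀ y ∉ K, G y = 0) :
    pullChart c G ∈ testFunctions n M := by
  have ht := tsupport_pullChart_subset hK hKt hG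
  refine ⟨contMDiff_of_tsupport fun x hx => ?_,
    (isCompact_chart_symm_image hK hKt).of_isClosed_subset (isClosed_tsupport _) ht⟩
  have hxs : x ∈ (chartAt (EuclideanSpace ℝ (Fin n)) c).source := by
    obtain ⟨y, hy, rfl⟩ := ht hx
    exact OpenPartialHomeomorph.map_target _ (hKt hy)
  have h1 : ContMDiffAt (𝓡 n) 𝓘(ℝ, ℂ) ∞ (G ∘ chartAt (EuclideanSpace ℝ (Fin n)) c) x :=
    (hGs.contMDiff _).comp x ((contMDiffOn_chart (I := 𝓡 n) (n := ∞) (x := c)).contMDiffAt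
      ((chartAt (EuclideanSpace ℝ (Fin n)) c).open_source.mem_nhds hxs))
  refine h1.congr_of_eventuallyEq ?_
  filter_upwards [(chartAt (EuclideanSpace ℝ (Fin n)) c).open_source.mem_nhds hxs] with z hz
  exact pullChart_of_mem hz G

theorem complexDifferential_eq_zero {f : M → ℂ} {x : M} (hx : x ∉ tsupport f) :
    complexDifferential (n := n) f x = 0 := by
  have h := notMem_tsupport_iff_eventuallyEq.1 hx
  unfold complexDifferential
  rw [h.mfderiv_eq]
  exact mfderiv_const

theorem complexDifferential_pullChart [IsManifold (𝓡 n) ∞ M] {c x : M}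
    (hx : x ∈ (chartAt (EuclideanSpace ℝ (Fin n)) c).source) {G : EuclideanSpace ℝ (Fin n) → ℂ}
    (hG : DifferentiableAt ℝ G (chartAt (EuclideanSpace ℝ (Fin n)) c x))
    (v : TangentSpace (𝓡 n) x) :
    complexDifferential (pullChart c G) x v =
      fderiv ℝ G (chartAt (EuclideanSpace ℝ (Fin n)) c x) (chartDiff c x v) := by
  have h : pullChart c G =ᶠ[𝓝 x] G ∘ chartAt (EuclideanSpace ℝ (Fin n)) c := by
    filter_upwards [(chartAt (EuclideanSpace ℝ (Fin n)) c).open_source.mem_nhds hx] with z hz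
    exact pullChart_of_mem hz G
  unfold complexDifferential
  rw [h.mfderiv_eq, mfderiv_comp (I' := 𝓡 n) x hG.mdifferentiableAt
    ((chart_mdifferentiable c).mdifferentiableAt hx), mfderiv_eq_fderiv]
  rfl

theorem dForm_eq_fderiv_chart [IsManifold (𝓡 n) ∞ M] {H : M → ℝ}
    (hH : ContMDiff (𝓡 n) 𝓘(ℝ, ℝ) ∞ H) {c x : M}
    (hx : x ∈ (chartAt (EuclideanSpace ℝ (Fin n)) c).source) (v : TangentSpace (𝓡 n) x) :
    dForm H x ![v] = fderiv ℝ (H ∘ (chartAt (EuclideanSpace ℝ (Fin n)) c).symm)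
      (chartAt (EuclideanSpace ℝ (Fin n)) c x) (chartDiff c x v) := by
  set φ := chartAt (EuclideanSpace ℝ (Fin n)) c
  have h : H =ᶠ[𝓝 x] (H ∘ φ.symm) ∘ φ := by
    filter_upwards [φ.open_source.mem_nhds hx] with z hz
    simp [φ.left_inv hz]
  have hs : MDifferentiableAt (𝓡 n) 𝓘(ℝ, ℝ) (H ∘ φ.symm) (φ x) :=
    ((hH _).mdifferentiableAt (by simp)).comp _
      ((chart_mdifferentiable c).mdifferentiableAt_symm (φ.map_source hx))
  change mfderiv (𝓡 n) 𝓘(ℝ, ℝ) H x v = _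
  rw [h.mfderiv_eq, mfderiv_comp (I' := 𝓡 n) x hs
    ((chart_mdifferentiable c).mdifferentiableAt hx), mfderiv_eq_fderiv]
  rfl

theorem dForm_congr_add_const {H K : M → ℝ} {x : M} {a : ℝ}
    (hH : MDifferentiableAt (𝓡 n) 𝓘(ℝ, ℝ) H x) (h : K =ᶠ[𝓝 x] fun y => H y + a) :
    dForm (n := n) K x = dForm H x := by
  have h1 : mfderiv (𝓡 n) 𝓘(ℝ, ℝ) (fun y => H y + a) x = mfderiv (𝓡 n) 𝓘(ℝ, ℝ) H x :=
    (hH.hasMFDerivAt.add (hasMFDerivAt_const a x)).mfderiv.trans (add_zero _)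
  unfold dForm
  rw [h.mfderiv_eq, h1]

theorem contDiffOn_comp_chart_symm [IsManifold (𝓡 n) ∞ M] {H : M → ℝ}
    (hH : ContMDiff (𝓡 n) 𝓘(ℝ, ℝ) ∞ H) (c : M) :
    ContDiffOn ℝ ∞ (H ∘ (chartAt (EuclideanSpace ℝ (Fin n)) c).symm)
      (chartAt (EuclideanSpace ℝ (Fin n)) c).target :=
  contMDiffOn_iff_contDiffOn.1 (hH.comp_contMDiffOn
    (contMDiffOn_chart_symm (I := 𝓡 n) (n := ∞) (x := c)))

/-- The Boltzmann density `ρ e^{βH}` in the preferred chart at `c`. -/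
def SymplecticForm.boltzmann (σ : SymplecticForm n M) (c : M) (β : ℝ) (H : M → ℝ)
    (y : EuclideanSpace ℝ (Fin n)) : ℝ :=
  σ.density c y * Real.exp (β * H ((chartAt (EuclideanSpace ℝ (Fin n)) c).symm y))

theorem SymplecticForm.boltzmann_pos [IsManifold (𝓡 n) ∞ M] (σ : SymplecticForm n M)
    (c : M) (β : ℝ) (H : M → ℝ) {y : EuclideanSpace ℝ (Fin n)}
    (hy : y ∈ (chartAt (EuclideanSpace ℝ (Fin n)) c).target) : 0 < σ.boltzmann c β H y :=
  mul_pos (σ.density_pos c hy) (Real.exp_pos _)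

theorem SymplecticForm.contDiffOn_boltzmann [IsManifold (𝓡 n) ∞ M] (σ : SymplecticForm n M)
    (c : M) (β : ℝ) {H : M → ℝ} (hH : ContMDiff (𝓡 n) 𝓘(ℝ, ℝ) ∞ H) :
    ContDiffOn ℝ ∞ (σ.boltzmann c β H) (chartAt (EuclideanSpace ℝ (Fin n)) c).target :=
  (σ.contDiffOn_density c).mul
    (Real.contDiff_exp.comp_contDiffOn (contDiffOn_const.mul (contDiffOn_comp_chart_symm hH c)))

theorem SymplecticForm.fderiv_boltzmann [IsManifold (𝓡 n) ∞ M] (σ : SymplecticForm n M)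
    (c : M) (β : ℝ) {H : M → ℝ} (hH : ContMDiff (𝓡 n) 𝓘(ℝ, ℝ) ∞ H) {y : EuclideanSpace ℝ (Fin n)}
    (hy : y ∈ (chartAt (EuclideanSpace ℝ (Fin n)) c).target) {P : Matrix (Fin n) (Fin n) ℝ}
    (hP : P * σ.chartMatrix c y = 1) (k : Fin n) :
    fderiv ℝ (σ.boltzmann c β H) y (stdVec k) = σ.boltzmann c β H y *
      (∑ i, ∑ j, P j i * fderiv ℝ (fun y => σ.chartMatrix c y k j) y (stdVec i) +
        β * fderiv ℝ (H ∘ (chartAt (EuclideanSpace ℝ (Fin n)) c).symm) y (stdVec k)) := by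
  have hnhds := (chartAt (EuclideanSpace ℝ (Fin n)) c).open_target.mem_nhds hy
  have h1 := (((σ.contDiffOn_density c).contDiffAt hnhds).differentiableAt
    (by simp)).hasFDerivAt
  have h2 := (((contDiffOn_comp_chart_symm hH c).contDiffAt hnhds).differentiableAt
    (by simp)).hasFDerivAt
  have h3 := (h1.mul (h2.const_mul β).exp).fderiv
  change fderiv ℝ (fun y => σ.density c y * Real.exp
    (β * (H ∘ (chartAt (EuclideanSpace ℝ (Fin n)) c).symm) y)) y (stdVec k) = _
  erw [h3]
  simp only [add_apply, smul_apply, smul_eq_mul, σ.fderiv_density c hy hP]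
  simp only [SymplecticForm.boltzmann, Function.comp_apply]
  ring

/-- In a chart, a functional satisfying the classical KMS condition kills the partial derivatives
of test functions once these are divided by the Boltzmann density `ρ e^{βH}`. -/
theorem apply_pullChart_fderiv_eq_zero [IsManifold (𝓡 n) ∞ M] [T2Space M] {σ : SymplecticForm n M}
    (X : SymplecticVectorField σ) {β : ℝ} {T : (M → ℂ) →ₗ[ℂ] ℂ}
    (hT : ∀ f ∈ testFunctions n M, ∀ g ∈ testFunctions n M, T (σ.poisson f g) =
      β * T (fun x => f x * complexDifferential g x (X.field x)))
    {c : M} {H : M → ℝ} (hH : ContMDiff (𝓡 n) 𝓘(ℝ, ℝ) ∞ H)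
    {p : EuclideanSpace ℝ (Fin n)} {r : ℝ} (hr : 0 < r)
    (hball : Metric.closedBall p (3 * r) ⊆ (chartAt (EuclideanSpace ℝ (Fin n)) c).target)
    (hX : ∀ x ∈ (chartAt (EuclideanSpace ℝ (Fin n)) c).source,
      chartAt (EuclideanSpace ℝ (Fin n)) c x ∈ Metric.closedBall p (2 * r) →
        interior₂ σ.form X.field x = dForm H x)
    {W : EuclideanSpace ℝ (Fin n) → ℂ} (hW : ContDiff ℝ ∞ W)
    (hWs : tsupport W ⊆ Metric.closedBall p (2 * r)) (k : Fin n) :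
    T (pullChart c fun y => (σ.boltzmann c β H y)⁻¹ • fderiv ℝ W y (stdVec k)) = 0 := by
  set φ := chartAt (EuclideanSpace ℝ (Fin n)) c with hφ
  set D := σ.boltzmann c β H with hD
  have h23 : Metric.closedBall p (2 * r) ⊆ Metric.closedBall p (3 * r) :=
    Metric.closedBall_subset_closedBall (by linarith)
  have hB2 : Metric.closedBall p (2 * r) ⊆ φ.target := h23.trans hball
  have hK2 := isCompact_closedBall p (2 * r)
  have hK3 := isCompact_closedBall p (3 * r)
  have hDs : ContDiffOn ℝ ∞ D φ.target := σ.contDiffOn_boltzmann c β hH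
  have hDne : ∀ y ∈ φ.target, D y ≠ 0 := fun y hy => (σ.boltzmann_pos c β H hy).ne'
  have hW0 : ∀ y ∉ Metric.closedBall p (2 * r), W y = 0 := fun y hy =>
    image_eq_zero_of_notMem_tsupport fun h => hy (hWs h)
  -- The classical KMS condition is applied to the pairs `(ω_{kj} F, y_j)`, where the coordinate
  -- `y_j` is cut off outside a neighbourhood of the support of `F`.
  let F : EuclideanSpace ℝ (Fin n) → ℂ := fun y => (D y)⁻¹ • W y
  have hF0 : ∀ y ∉ Metric.closedBall p (2 * r), F y = 0 := fun y hy => by simp [F, hW0 y hy]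
  have smooth_mul : ∀ {a : EuclideanSpace ℝ (Fin n) → ℝ}, ContDiffOn ℝ ∞ a φ.target →
      ContDiff ℝ ∞ fun y => a y • F y := by
    intro a ha
    refine contMDiff_iff_contDiff.1 (contMDiff_of_tsupport fun y hy => ContDiffAt.contMDiffAt ?_)
    have hy' : y ∈ φ.target := hB2 (closure_minimal (fun z hz => by
      by_contra h
      exact hz (by simp [hF0 z h])) Metric.isClosed_closedBall hy)
    have hn := φ.open_target.mem_nhds hy'
    exact (ha.contDiffAt hn).smul (((hDs.contDiffAt hn).inv (hDne y hy')).smul hW.contDiffAt)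
  have hFj : ∀ j, ContDiff ℝ ∞ fun y => σ.chartMatrix c y k j • F y := fun j =>
    smooth_mul (σ.contDiffOn_chartMatrix c k j)
  have hFj0 : ∀ j, ∀ y ∉ Metric.closedBall p (2 * r), σ.chartMatrix c y k j • F y = 0 :=
    fun j y hy => by rw [hF0 y hy, smul_zero]
  let χ : ContDiffBump p := ⟨5 / 2 * r, 3 * r, by positivity, by linarith⟩
  let y' : Fin n → EuclideanSpace ℝ (Fin n) → ℂ := fun j y => ((χ y * y j : ℝ) : ℂ)
  have hy's : ∀ j, ContDiff ℝ ∞ (y' j) := fun j =>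
    Complex.ofRealCLM.contDiff.comp (χ.contDiff.mul (by fun_prop))
  have hy'0 : ∀ j, ∀ y ∉ Metric.closedBall p (3 * r), y' j y = 0 := fun j y hy => by
    have : χ y = 0 := χ.zero_of_le_dist (not_lt.1 fun h => hy (Metric.ball_subset_closedBall h))
    simp [y', this]
  let f : Fin n → M → ℂ := fun j => pullChart c fun y => σ.chartMatrix c y k j • F y
  let g : Fin n → M → ℂ := fun j => pullChart c (y' j)
  have key := fun j => hT (f j) (pullChart_mem_testFunctions hK2 hB2 (hFj j) (hFj0 j))
    (g j) (pullChart_mem_testFunctions hK3 hball (hy's j) (hy'0 j))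
  have heq : (pullChart c fun y => (D y)⁻¹ • fderiv ℝ W y (stdVec k)) =
      ∑ j, σ.poisson (f j) (g j) -
        (β : ℂ) • ∑ j, fun x => f j x * complexDifferential (g j) x (X.field x) := by
    ext x
    simp only [Pi.sub_apply, Pi.smul_apply, Finset.sum_apply, smul_eq_mul]
    by_cases hx : x ∈ φ.symm '' Metric.closedBall p (2 * r)
    swap
    · have hf0 : ∀ j, f j x = 0 := fun j => pullChart_of_notMem_image hx (hFj0 j)
      have hdf0 : ∀ j, complexDifferential (n := n) (f j) x = 0 := fun j =>
        complexDifferential_eq_zero fun h => hx (tsupport_pullChart_subset hK2 hB2 (hFj0 j) h)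
      rw [pullChart_of_notMem_image hx fun y hy => by
        rw [fderiv_of_notMem_tsupport ℝ fun h => hy (hWs h)]; simp]
      simp only [hf0, SymplecticForm.poisson, hdf0]
      simp
    · obtain ⟨hxs, hxB⟩ : x ∈ φ.source ∧ φ x ∈ Metric.closedBall p (2 * r) := by
        obtain ⟨y, hy, rfl⟩ := hx
        exact ⟨φ.map_target (hB2 hy), by rwa [φ.right_inv (hB2 hy)]⟩
      have hyt : φ x ∈ φ.target := φ.map_source hxs
      have hn := φ.open_target.mem_nhds hyt
      set P := (σ.chartMatrix c (φ x))⁻¹ with hPdef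
      have hP : P * σ.chartMatrix c (φ x) = 1 :=
        Matrix.nonsing_inv_mul _ (isUnit_iff_ne_zero.2 (σ.chartMatrix_det_ne_zero c hyt))
      have hP' : σ.chartMatrix c (φ x) * P = 1 := mul_eq_one_comm.1 hP
      have hDd := ((hDs.contDiffAt hn).differentiableAt (by simp)).hasFDerivAt
      have hWd := (hW.differentiable (by simp) (φ x)).hasFDerivAt
      have hinv : HasFDerivAt (fun y => (D y)⁻¹) ((-(D (φ x) ^ 2)⁻¹) • fderiv ℝ D (φ x)) (φ x) :=
        (hasDerivAt_inv (hDne _ hyt)).comp_hasFDerivAt (φ x) hDd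
      have hFd : HasFDerivAt F _ (φ x) := hinv.smul hWd
      have hwd : ∀ j, HasFDerivAt (fun y => σ.chartMatrix c y k j)
          (fderiv ℝ (fun y => σ.chartMatrix c y k j) (φ x)) (φ x) := fun j =>
        (((σ.contDiffOn_chartMatrix c k j).contDiffAt hn).differentiableAt (by simp)).hasFDerivAt
      have hL : ∀ j v, fderiv ℝ (fun y => σ.chartMatrix c y k j • F y) (φ x) v =
          σ.chartMatrix c (φ x) k j • fderiv ℝ F (φ x) v +
            (fderiv ℝ (fun y => σ.chartMatrix c y k j) (φ x) v) • F (φ x) := by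
        intro j v
        exact DFunLike.congr_fun ((hwd j).smul hFd.differentiableAt.hasFDerivAt).fderiv v
      have hg : ∀ j v, complexDifferential (g j) x v = ((chartDiff c x v j : ℝ) : ℂ) := by
        intro j v
        have hev : y' j =ᶠ[𝓝 (φ x)] fun y => ((y j : ℝ) : ℂ) := by
          have : φ x ∈ Metric.ball p (5 / 2 * r) :=
            Metric.closedBall_subset_ball (by linarith) hxB
          filter_upwards [Metric.isOpen_ball.mem_nhds this] with z hz
          have : χ z = 1 := χ.one_of_mem_closedBall (Metric.ball_subset_closedBall hz)
          simp [y', this]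
        have hproj : HasFDerivAt (fun y : EuclideanSpace ℝ (Fin n) => ((y j : ℝ) : ℂ))
            (Complex.ofRealCLM.comp (EuclideanSpace.proj j)) (φ x) :=
          (Complex.ofRealCLM.comp (EuclideanSpace.proj j : EuclideanSpace ℝ (Fin n) →L[ℝ] ℝ)
            ).hasFDerivAt
        rw [complexDifferential_pullChart hxs ((hy's j).differentiable (by simp) _),
          hev.fderiv_eq, hproj.fderiv]
        rfl
      have hpo : ∀ j, σ.poisson (f j) (g j) x = ∑ i, ((P j i : ℝ) : ℂ) *
          fderiv ℝ (fun y => σ.chartMatrix c y k j • F y) (φ x) (stdVec i) := fun j =>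
        σ.poisson_coordinate c hxs hP
          (fun v => complexDifferential_pullChart hxs ((hFj j).differentiable (by simp) _) v) (hg j)
      -- The brackets add up to `∂_k F` plus `F` times the divergence of `ω⁻¹`.
      have hsum1 : ∑ j, σ.poisson (f j) (g j) x =
          ((∑ i, ∑ j, P j i * fderiv ℝ (fun y => σ.chartMatrix c y k j) (φ x) (stdVec i) : ℝ) : ℂ) *
            F (φ x) + fderiv ℝ F (φ x) (stdVec k) := by
        have h1 : ∀ i, ∑ j, ((σ.chartMatrix c (φ x) k j : ℝ) : ℂ) * ((P j i : ℝ) : ℂ) =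
            if k = i then 1 else 0 := by
          intro i
          have := congrFun (congrFun hP' k) i
          rw [Matrix.mul_apply, Matrix.one_apply] at this
          have h2 := congrArg (fun t : ℝ => (t : ℂ)) this
          simp only [Complex.ofReal_sum, Complex.ofReal_mul] at h2
          rw [h2]
          split_ifs <;> simp
        simp only [hpo, hL]
        simp only [Complex.real_smul]
        rw [Finset.sum_comm]
        have h3 : ∀ i, ∑ j, ((P j i : ℝ) : ℂ) * (((σ.chartMatrix c (φ x) k j : ℝ) : ℂ) *
              fderiv ℝ F (φ x) (stdVec i) +
            ((fderiv ℝ (fun y => σ.chartMatrix c y k j) (φ x) (stdVec i) : ℝ) : ℂ) * F (φ x)) =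
            (if k = i then 1 else 0) * fderiv ℝ F (φ x) (stdVec i) +
            ((∑ j, P j i * fderiv ℝ (fun y => σ.chartMatrix c y k j) (φ x) (stdVec i) : ℝ) : ℂ) *
              F (φ x) := by
          intro i
          rw [← h1 i, Complex.ofReal_sum, Finset.sum_mul, Finset.sum_mul, ← Finset.sum_add_distrib]
          refine Finset.sum_congr rfl fun j _ => ?_
          push_cast
          ring
        rw [Finset.sum_congr rfl fun i _ => h3 i, Finset.sum_add_distrib, ← Finset.sum_mul,
          ← Complex.ofReal_sum, add_comm]
        simp
      -- `∑ⱼ ω_{kj} dy_j(X)` is `σ(∂_k, X) = -∂_k H`.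
      have hsum2 : ∑ j, f j x * complexDifferential (g j) x (X.field x) =
          -(F (φ x) * ((fderiv ℝ (H ∘ φ.symm) (φ x) (stdVec k) : ℝ) : ℂ)) := by
        obtain ⟨v, hv⟩ := chartDiff_surjective c hxs (stdVec k)
        have h1 : fderiv ℝ (H ∘ φ.symm) (φ x) (stdVec k) = σ.form x ![X.field x, v] := by
          rw [← hv, ← dForm_eq_fderiv_chart hH hxs, ← hX x hxs hxB, interior₂_apply]
          rfl
        rw [h1, ← σ.chartForm_chartDiff c hxs, alternating_pair_swap, hv, apply_pair_right]
        simp only [hg]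
        have h2 : ∀ j, f j x = ((σ.chartMatrix c (φ x) k j : ℝ) : ℂ) * F (φ x) := fun j =>
          pullChart_of_mem hxs _
        simp only [h2]
        push_cast
        rw [mul_neg, neg_neg, Finset.mul_sum]
        refine Finset.sum_congr rfl fun j _ => ?_
        change _ = F (φ x) * (((chartDiff c x (X.field x) j : ℝ) : ℂ) *
          ((σ.chartMatrix c (φ x) k j : ℝ) : ℂ))
        ring
      rw [hsum1, hsum2, pullChart_of_mem hxs, ← hφ]
      have hDk := σ.fderiv_boltzmann c β hH hyt hP k
      rw [← hD, ← hφ] at hDk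
      have hne : ((D (φ x) : ℝ) : ℂ) ≠ 0 := Complex.ofReal_ne_zero.2 (hDne _ hyt)
      have hFk : fderiv ℝ F (φ x) (stdVec k) = ((D (φ x) : ℝ) : ℂ)⁻¹ * fderiv ℝ W (φ x) (stdVec k) -
          (((D (φ x) : ℝ) : ℂ) ^ 2)⁻¹ * ((fderiv ℝ D (φ x) (stdVec k) : ℝ) : ℂ) * W (φ x) := by
        rw [hFd.fderiv]
        simp
        ring
      rw [hFk, hDk]
      simp only [F, Complex.real_smul]
      push_cast
      field_simp
      ring
  rw [heq, map_sub, map_smul, map_sum, map_sum]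
  simp only [key, smul_eq_mul, Finset.mul_sum, sub_self]

end LocalKMS

/-! ### The Liouville integral -/

section Liouville

open MeasureTheory

variable {n : ℕ} {M : Type*} [TopologicalSpace M] [ChartedSpace (EuclideanSpace ℝ (Fin n)) M]

/-- The Liouville integral of `f` over the domain of the preferred chart at `c`. It is the integral
over `M` when `f` vanishes outside that domain. -/
def SymplecticForm.liouville (σ : SymplecticForm n M) (c : M) (f : M → ℂ) : ℂ :=
  ∫ y in (chartAt (EuclideanSpace ℝ (Fin n)) c).target,
    σ.density c y • f ((chartAt (EuclideanSpace ℝ (Fin n)) c).symm y)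

theorem SymplecticForm.density_eq_abs_det_mul [IsManifold (𝓡 n) ∞ M] (σ : SymplecticForm n M)
    {c c' x : M} (hx : x ∈ (chartAt (EuclideanSpace ℝ (Fin n)) c).source)
    (hx' : x ∈ (chartAt (EuclideanSpace ℝ (Fin n)) c').source)
    {L : EuclideanSpace ℝ (Fin n) →L[ℝ] EuclideanSpace ℝ (Fin n)}
    (hL : ∀ v, L (chartDiff c x v) = chartDiff c' x v) :
    σ.density c (chartAt (EuclideanSpace ℝ (Fin n)) c x) =
      |L.det| * σ.density c' (chartAt (EuclideanSpace ℝ (Fin n)) c' x) := by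
  have h : chartForm σ.form c (chartAt (EuclideanSpace ℝ (Fin n)) c x) =
      (chartForm σ.form c' (chartAt (EuclideanSpace ℝ (Fin n)) c' x)).compContinuousLinearMap L := by
    ext u
    obtain ⟨v, hv⟩ := chartDiff_surjective c hx (u 0)
    obtain ⟨w, hw⟩ := chartDiff_surjective c hx (u 1)
    have hu : u = ![chartDiff c x v, chartDiff c x w] := by
      ext1 i; fin_cases i
      · exact hv.symm
      · exact hw.symm
    rw [hu, σ.chartForm_chartDiff c hx, ← σ.chartForm_chartDiff c' hx',
      ContinuousAlternatingMap.compContinuousLinearMap_apply]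
    congr 1
    ext1 i; fin_cases i
    · exact (hL v).symm
    · exact (hL w).symm
  unfold SymplecticForm.density SymplecticForm.chartMatrix
  rw [h, det_formMatrix_comp, abs_mul, Real.sqrt_mul (abs_nonneg _), abs_pow,
    Real.sqrt_sq (abs_nonneg _)]

/-- The Liouville integral does not depend on the chart: densities transform by the absolute value
of the Jacobian, as determinants of forms transform by its square. -/
theorem SymplecticForm.liouville_eq [IsManifold (𝓡 n) ∞ M] (σ : SymplecticForm n M) {c c' : M}
    {f : M → ℂ} (hf : ∀ x, f x ≠ 0 → x ∈ (chartAt (EuclideanSpace ℝ (Fin n)) c).source ∧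
      x ∈ (chartAt (EuclideanSpace ℝ (Fin n)) c').source) :
    σ.liouville c f = σ.liouville c' f := by
  set φ := chartAt (EuclideanSpace ℝ (Fin n)) c with hφ
  set φ' := chartAt (EuclideanSpace ℝ (Fin n)) c' with hφ'
  have hrestr : ∀ c₁ c₂ : M, (∀ x, f x ≠ 0 → x ∈ (chartAt (EuclideanSpace ℝ (Fin n)) c₂).source) →
      σ.liouville c₁ f = ∫ y in ((chartAt (EuclideanSpace ℝ (Fin n)) c₁).symm.trans
        (chartAt (EuclideanSpace ℝ (Fin n)) c₂)).source,
        σ.density c₁ y • f ((chartAt (EuclideanSpace ℝ (Fin n)) c₁).symm y) := by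
    intro c₁ c₂ h
    refine setIntegral_eq_of_subset_of_forall_sdiff_eq_zero
      (chartAt (EuclideanSpace ℝ (Fin n)) c₁).open_target.measurableSet
      (fun y hy => hy.1) fun y hy => ?_
    have : f ((chartAt (EuclideanSpace ℝ (Fin n)) c₁).symm y) = 0 := by
      by_contra h0
      exact hy.2 ⟨hy.1, h _ h0⟩
    rw [this, smul_zero]
  rw [hrestr c c' fun x hx => (hf x hx).2, hrestr c' c fun x hx => (hf x hx).1]
  set ψ := φ.symm.trans φ' with hψ
  have himg : (φ'.symm.trans φ).source = ψ '' ψ.source := by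
    rw [ψ.image_source_eq_target, hψ]
    have : φ'.symm.trans φ = (φ.symm.trans φ').symm := by
      rw [OpenPartialHomeomorph.trans_symm_eq_symm_trans_symm, OpenPartialHomeomorph.symm_symm]
    rw [this]
    rfl
  have hψd : ∀ y ∈ ψ.source, MDifferentiableAt (𝓡 n) (𝓡 n) ψ y := fun y hy =>
    ((chart_mdifferentiable c').mdifferentiableAt hy.2).comp y
      ((chart_mdifferentiable c).mdifferentiableAt_symm hy.1)
  have hψf : ∀ y ∈ ψ.source, HasFDerivWithinAt ψ (fderiv ℝ ψ y) ψ.source y := fun y hy =>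
    (hψd y hy).differentiableAt.hasFDerivAt.hasFDerivWithinAt
  rw [himg, integral_image_eq_integral_abs_det_fderiv_smul volume ψ.open_source.measurableSet hψf
    ψ.injOn]
  refine setIntegral_congr_fun ψ.open_source.measurableSet fun y hy => ?_
  obtain ⟨x, hx, rfl⟩ : ∃ x ∈ φ.source, φ x = y := ⟨φ.symm y, φ.map_target hy.1, φ.right_inv hy.1⟩
  have hx' : x ∈ φ'.source := by
    have := hy.2
    simpa [φ.left_inv hx] using this
  have hψx : ψ (φ x) = φ' x := by simp [hψ, φ.left_inv hx]
  have hL : ∀ v, fderiv ℝ ψ (φ x) (chartDiff c x v) = chartDiff c' x v := by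
    intro v
    have h1 : φ' =ᶠ[𝓝 x] ψ ∘ φ := by
      filter_upwards [φ.open_source.mem_nhds hx] with z hz
      simp [hψ, φ.left_inv hz]
    have h2 : mfderiv (𝓡 n) (𝓡 n) φ' x = _ := h1.mfderiv_eq
    rw [mfderiv_comp (I' := 𝓡 n) x (hψd _ hy) ((chart_mdifferentiable c).mdifferentiableAt hx),
      mfderiv_eq_fderiv] at h2
    exact (DFunLike.congr_fun h2 v).symm
  have := σ.density_eq_abs_det_mul hx hx' hL
  rw [← hφ, ← hφ'] at this
  simp only [← hφ, ← hφ', φ.left_inv hx, hψx, φ'.left_inv hx']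
  rw [smul_smul, ← this]

end Liouville

/-! ### From local to global Hamiltonians -/

section Globalization

open MeasureTheory

variable {n : ℕ} {M : Type*} [TopologicalSpace M] [ChartedSpace (EuclideanSpace ℝ (Fin n)) M]
  [IsManifold (𝓡 n) ∞ M] [T2Space M]

/-- On test functions supported in `V`, the functional `T` is integration against `κ e^{βH}` times
the Liouville volume, computed in the preferred chart at `c`. -/
def IsBoltzmannOn (σ : SymplecticForm n M) (T : (M → ℂ) →ₗ[ℂ] ℂ) (β : ℝ) (c : M) (V : Set M)
    (H : M → ℝ) (κ : ℂ) : Prop :=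
  ∀ f ∈ testFunctions n M, tsupport f ⊆ V →
    T f = κ * σ.liouville c (fun x => Real.exp (β * H x) • f x)

/-- A functional satisfying the classical KMS condition is locally given by a Boltzmann density. -/
theorem exists_isBoltzmannOn {σ : SymplecticForm n M}
    (X : SymplecticVectorField σ) {β : ℝ} {T : (M → ℂ) →ₗ[ℂ] ℂ}
    (hT : ∀ f ∈ testFunctions n M, ∀ g ∈ testFunctions n M, T (σ.poisson f g) =
      β * T (fun x => f x * complexDifferential g x (X.field x)))
    {c : M} {H : M → ℝ} (hH : IsLocalHamiltonian X c H) :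
    ∃ V : Set M, IsOpen V ∧ c ∈ V ∧ V ⊆ (chartAt (EuclideanSpace ℝ (Fin n)) c).source ∧
      (∀ x ∈ V, interior₂ σ.form X.field x = dForm H x) ∧ ∃ κ, IsBoltzmannOn σ T β c V H κ := by
  set φ := chartAt (EuclideanSpace ℝ (Fin n)) c with hφ
  have ht : Filter.Tendsto φ.symm (𝓝 (φ c)) (𝓝 c) := by
    have := φ.continuousAt_symm (mem_chart_target _ c)
    rwa [ContinuousAt, φ.left_inv (mem_chart_source _ c)] at this
  obtain ⟨ε, hε, hball⟩ := Metric.mem_nhds_iff.1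
    ((ht.eventually hH.2).and (φ.open_target.mem_nhds (mem_chart_target _ c)))
  have hr : 0 < ε / 4 := by positivity
  set r := ε / 4 with hrdef
  have h3 : Metric.closedBall (φ c) (3 * r) ⊆ Metric.ball (φ c) ε :=
    Metric.closedBall_subset_ball (by rw [hrdef]; linarith)
  have h2 : Metric.closedBall (φ c) (2 * r) ⊆ Metric.ball (φ c) ε :=
    Metric.closedBall_subset_ball (by rw [hrdef]; linarith)
  have h1 : Metric.ball (φ c) r ⊆ Metric.ball (φ c) ε :=
    Metric.ball_subset_ball (by rw [hrdef]; linarith)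
  have hX : ∀ x ∈ φ.source, φ x ∈ Metric.ball (φ c) ε →
      interior₂ σ.form X.field x = dForm H x := by
    intro x hx hxB
    have h := (hball hxB).1
    rwa [φ.left_inv hx] at h
  have hD : ContDiffOn ℝ ∞ (σ.boltzmann c β H) φ.target := σ.contDiffOn_boltzmann c β hH.1
  have hDne : ∀ y ∈ φ.target, σ.boltzmann c β H y ≠ 0 := fun y hy =>
    (σ.boltzmann_pos c β H hy).ne'
  let ν : (EuclideanSpace ℝ (Fin n) → ℂ) →ₗ[ℂ] ℂ := (T.comp (pullChart c)).comp
    (LinearMap.pi fun y => ((σ.boltzmann c β H y)⁻¹ : ℝ) • LinearMap.proj y)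
  have hν : ∀ G, ν G = T (pullChart c fun y => (σ.boltzmann c β H y)⁻¹ • G y) := fun G => rfl
  obtain ⟨κ, hκ⟩ := exists_eq_const_mul_integral ν (φ c) hr fun W hW hWs k => by
    rw [hν]
    exact apply_pullChart_fderiv_eq_zero X hT hH.1 hr (fun y hy => (hball (h3 hy)).2)
      (fun x hx hxB => hX x hx (h2 hxB)) hW hWs k
  refine ⟨φ.source ∩ φ ⁻¹' Metric.ball (φ c) r, φ.isOpen_inter_preimage Metric.isOpen_ball,
    ⟨mem_chart_source _ c, Metric.mem_ball_self hr⟩, Set.inter_subset_left,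
    fun x hx => hX x hx.1 (h1 hx.2), κ, fun f hf hfs => ?_⟩
  let G : EuclideanSpace ℝ (Fin n) → ℂ :=
    φ.target.indicator fun y => σ.boltzmann c β H y • f (φ.symm y)
  have hK : IsCompact (φ '' tsupport f) := hf.2.image_of_continuousOn
    (φ.continuousOn.mono fun x hx => (hfs hx).1)
  have hGK : tsupport G ⊆ φ '' tsupport f := by
    refine closure_minimal (fun y hy => ?_) hK.isClosed
    have hyt : y ∈ φ.target := by
      by_contra h
      exact hy (Set.indicator_of_notMem h _)
    refine ⟨φ.symm y, subset_tsupport _ fun h => hy ?_, φ.right_inv hyt⟩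
    simp only [G]
    rw [Set.indicator_of_mem hyt, h, smul_zero]
  have hGs : ContDiff ℝ ∞ G := by
    refine contMDiff_iff_contDiff.1 (contMDiff_of_tsupport fun y hy => ContDiffAt.contMDiffAt ?_)
    have hyt : y ∈ φ.target := by
      obtain ⟨x, hx, rfl⟩ := hGK hy
      exact φ.map_source (hfs hx).1
    have hn := φ.open_target.mem_nhds hyt
    have hfc : ContDiffAt ℝ ∞ (fun y => f (φ.symm y)) y :=
      contMDiffAt_iff_contDiffAt.1 ((hf.1 _).comp y
        ((contMDiffOn_chart_symm (I := 𝓡 n) (n := ∞) (x := c)).contMDiffAt hn))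
    refine ((hD.contDiffAt hn).smul hfc).congr_of_eventuallyEq ?_
    filter_upwards [hn] with z hz
    exact Set.indicator_of_mem hz _
  have hGB : tsupport G ⊆ Metric.closedBall (φ c) r := by
    intro y hy
    obtain ⟨x, hx, rfl⟩ := hGK hy
    exact Metric.ball_subset_closedBall (hfs hx).2
  have hfG : f = pullChart c fun y => (σ.boltzmann c β H y)⁻¹ • G y := by
    ext x
    by_cases hx : x ∈ φ.source
    · have hyt := φ.map_source hx
      rw [pullChart_of_mem hx, ← hφ]
      simp only [G]
      rw [Set.indicator_of_mem hyt, φ.left_inv hx, smul_smul, inv_mul_cancel₀ (hDne _ hyt),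
        one_smul]
    · have h0 : f x = 0 := image_eq_zero_of_notMem_tsupport fun h => hx (hfs h).1
      rw [h0]
      exact (Set.indicator_of_notMem hx _).symm
  have h4 := hκ G hGs hGB
  rw [hν, ← hfG] at h4
  rw [h4, SymplecticForm.liouville, ← hφ]
  simp only [G]
  rw [integral_indicator φ.open_target.measurableSet]
  simp only [SymplecticForm.boltzmann, smul_smul, ← hφ]

theorem integrable_test_smul {U : Set (EuclideanSpace ℝ (Fin n))} (hU : IsOpen U)
    {g : EuclideanSpace ℝ (Fin n) → ℝ}
    (hg : Continuous g) (hgc : HasCompactSupport g) (hgU : tsupport g ⊆ U)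
    {a : EuclideanSpace ℝ (Fin n) → ℂ} (ha : ContinuousOn a U) :
    Integrable fun y => g y • a y := by
  have hc : Continuous fun y => g y • a y := by
    refine continuous_of_tsupport fun y hy => ?_
    exact hg.continuousAt.smul
      (ha.continuousAt (hU.mem_nhds (hgU (tsupport_smul_subset_left g a hy))))
  exact hc.integrable_of_hasCompactSupport hgc.smul_right

/-- The Boltzmann densities of two representations agree on overlaps. -/
theorem IsBoltzmannOn.eq_on_overlap {σ : SymplecticForm n M} {T : (M → ℂ) →ₗ[ℂ] ℂ} {β : ℝ}
    {c c' : M} {V V' : Set M} {H H' : M → ℝ} {κ κ' : ℂ} (h : IsBoltzmannOn σ T β c V H κ)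
    (h' : IsBoltzmannOn σ T β c' V' H' κ') (hV : IsOpen V) (hV' : IsOpen V')
    (hVs : V ⊆ (chartAt (EuclideanSpace ℝ (Fin n)) c).source)
    (hVs' : V' ⊆ (chartAt (EuclideanSpace ℝ (Fin n)) c').source)
    (hH : ContMDiff (𝓡 n) 𝓘(ℝ, ℝ) ∞ H) (hH' : ContMDiff (𝓡 n) 𝓘(ℝ, ℝ) ∞ H')
    {x : M} (hx : x ∈ V) (hx' : x ∈ V') :
    κ * Real.exp (β * H x) = κ' * Real.exp (β * H' x) := by
  set φ := chartAt (EuclideanSpace ℝ (Fin n)) c with hφ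
  let U := φ.target ∩ φ.symm ⁻¹' (V ∩ V')
  have hU : IsOpen U := φ.isOpen_inter_preimage_symm (hV.inter hV')
  let a : (M → ℝ) → EuclideanSpace ℝ (Fin n) → ℂ := fun K y =>
    ((σ.density c y * Real.exp (β * K (φ.symm y)) : ℝ) : ℂ)
  have ha : ∀ K : M → ℝ, ContMDiff (𝓡 n) 𝓘(ℝ, ℝ) ∞ K → ContinuousOn (a K) U := fun K hK =>
    Complex.continuous_ofReal.comp_continuousOn
      ((σ.contDiffOn_boltzmann c β hK).continuousOn.mono Set.inter_subset_left)
  have hc : ContinuousOn (fun y => κ * a H y - κ' * a H' y) U :=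
    (continuousOn_const.mul (ha H hH)).sub (continuousOn_const.mul (ha H' hH'))
  have hae : ∀ᵐ y ∂(volume : Measure (EuclideanSpace ℝ (Fin n))),
      y ∈ U → κ * a H y - κ' * a H' y = 0 := by
    refine hU.ae_eq_zero_of_integral_contDiff_smul_eq_zero
      (hc.locallyIntegrableOn hU.measurableSet) fun g hg hgc hgU => ?_
    let f : M → ℂ := pullChart c fun y => (g y : ℂ)
    have hKt : tsupport g ⊆ φ.target := hgU.trans Set.inter_subset_left
    have hg0 : ∀ y ∉ tsupport g, (g y : ℂ) = 0 := fun y hy => by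
      rw [image_eq_zero_of_notMem_tsupport hy, Complex.ofReal_zero]
    have hf : f ∈ testFunctions n M :=
      pullChart_mem_testFunctions hgc hKt (Complex.ofRealCLM.contDiff.comp hg) hg0
    have hfs : tsupport f ⊆ V ∩ V' := by
      intro z hz
      obtain ⟨y, hy, rfl⟩ := tsupport_pullChart_subset hgc hKt hg0 hz
      exact (hgU hy).2
    have hint : ∀ K : M → ℝ, σ.liouville c (fun x => Real.exp (β * K x) • f x) =
        ∫ y, g y • a K y := by
      intro K
      have e : ∫ y in φ.target, g y • a K y = ∫ y, g y • a K y :=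
        setIntegral_eq_integral_of_forall_compl_eq_zero fun y hy => by
          rw [image_eq_zero_of_notMem_tsupport fun h => hy (hKt h), zero_smul]
      rw [SymplecticForm.liouville, ← hφ, ← e]
      refine setIntegral_congr_fun φ.open_target.measurableSet fun y hy => ?_
      have : f (φ.symm y) = g y := by
        rw [show f (φ.symm y) = _ from pullChart_of_mem (φ.map_target hy) _, φ.right_inv hy]
      simp only [this, a, Complex.real_smul]
      push_cast
      ring
    have e1 := h f hf (hfs.trans Set.inter_subset_left)
    have e2 := h' f hf (hfs.trans Set.inter_subset_right)
    rw [σ.liouville_eq (c := c') (c' := c) fun z hz => by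
      have : z ∈ V ∩ V' := hfs (subset_tsupport _ fun h0 => hz (by simp [h0]))
      exact ⟨hVs' this.2, hVs this.1⟩] at e2
    rw [hint] at e1 e2
    have hi : ∀ K : M → ℝ, ContMDiff (𝓡 n) 𝓘(ℝ, ℝ) ∞ K → Integrable fun y => g y • a K y :=
      fun K hK => integrable_test_smul hU hg.continuous hgc hgU (ha K hK)
    have e3 : (fun y => g y • (κ * a H y - κ' * a H' y)) =
        fun y => κ * (g y • a H y) - κ' * (g y • a H' y) := by
      ext y
      simp only [Complex.real_smul]
      ring
    rw [e3, integral_sub ((hi H hH).const_mul κ) ((hi H' hH').const_mul κ'),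
      integral_const_mul, integral_const_mul, ← e1, ← e2, sub_self]
  have hxs := hVs hx
  have hxU : φ x ∈ U := ⟨φ.map_source hxs, by
    change φ.symm (φ x) ∈ V ∩ V'
    rw [φ.left_inv hxs]
    exact ⟨hx, hx'⟩⟩
  have h0 := Measure.eqOn_open_of_ae_eq (μ := volume) (g := fun _ => (0 : ℂ))
    ((ae_restrict_iff' hU.measurableSet).2 hae) hU hc continuousOn_const hxU
  simp only [a, φ.left_inv hxs, Complex.ofReal_mul] at h0
  have hρ : ((σ.density c (φ x) : ℝ) : ℂ) ≠ 0 :=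
    Complex.ofReal_ne_zero.2 (σ.density_pos c (φ.map_source hxs)).ne'
  have : ((σ.density c (φ x) : ℝ) : ℂ) *
      (κ * Real.exp (β * H x) - κ' * Real.exp (β * H' x)) = 0 := by
    linear_combination h0
  exact sub_eq_zero.1 ((mul_eq_zero.1 this).resolve_left hρ)

/-- A functional on test functions that vanishes on functions supported in the members of an open
cover vanishes. -/
theorem apply_eq_zero_of_locally [SecondCountableTopology M] {T : (M → ℂ) →ₗ[ℂ] ℂ} {V : M → Set M}
    (hV : ∀ c, IsOpen (V c)) (hVc : ∀ c, c ∈ V c)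
    (hT : ∀ c, ∀ f ∈ testFunctions n M, tsupport f ⊆ V c → T f = 0)
    {f : M → ℂ} (hf : f ∈ testFunctions n M) : T f = 0 := by
  have : LocallyCompactSpace M := ChartedSpace.locallyCompactSpace (EuclideanSpace ℝ (Fin n)) M
  obtain ⟨ρ, hρ⟩ := SmoothPartitionOfUnity.exists_isSubordinate (𝓡 n) (s := (Set.univ : Set M))
    isClosed_univ V hV fun x _ => Set.mem_iUnion_of_mem x (hVc x)
  have hfin := ρ.locallyFinite.finite_nonempty_inter_compact hf.2
  have hsum : f = ∑ i ∈ hfin.toFinset, fun x => ρ i x • f x := by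
    ext x
    rw [Finset.sum_apply, ← Finset.sum_smul]
    by_cases hx : x ∈ tsupport f
    · have h1 : ∑ i ∈ hfin.toFinset, ρ i x = 1 := by
        rw [← ρ.sum_eq_one (Set.mem_univ x)]
        refine (finsum_eq_sum_of_support_subset _ fun i hi => ?_).symm
        rw [Set.Finite.coe_toFinset]
        exact ⟨x, hi, hx⟩
      rw [h1, one_smul]
    · rw [image_eq_zero_of_notMem_tsupport hx, smul_zero]
  rw [hsum, map_sum]
  refine Finset.sum_eq_zero fun i _ => hT i _ ⟨?_, ?_⟩ ?_
  · exact (ρ i).contMDiff.smul hf.1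
  · exact HasCompactSupport.smul_left (f := ρ i) hf.2
  · exact (tsupport_smul_subset_left (ρ i) f).trans (hρ i)

/-- A nonzero functional satisfying the classical KMS condition forces `i_X σ` to be exact. -/
theorem isExactOneForm_of_classical_KMS [SecondCountableTopology M] [ConnectedSpace M]
    {σ : SymplecticForm n M} (X : SymplecticVectorField σ) {β : ℝ} (hβ : β ≠ 0)
    {T : (M → ℂ) →ₗ[ℂ] ℂ} (hne : ∃ f ∈ testFunctions n M, T f ≠ 0)
    (hT : ∀ f ∈ testFunctions n M, ∀ g ∈ testFunctions n M, T (σ.poisson f g) =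
      β * T (fun x => f x * complexDifferential g x (X.field x))) :
    IsExactOneForm (interior₂ σ.form X.field) := by
  have hH := X.localHamiltonian_spec
  choose V hVo hcV hVs hVX κ hκ using fun c => exists_isBoltzmannOn X hT (hH c)
  -- Near `c` the function `K` is `κ_c e^{βH_c}`, although it is defined pointwise by choices.
  let K : M → ℂ := fun x => κ x * Real.exp (β * X.localHamiltonian x x)
  have hK : ∀ c, ∀ x ∈ V c, K x = κ c * Real.exp (β * X.localHamiltonian c x) := fun c x hx =>
    (hκ x).eq_on_overlap (hκ c) (hVo x) (hVo c) (hVs x) (hVs c) (hH x).1 (hH c).1 (hcV x) hx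
  have hK0 : ∀ c, ∀ x ∈ V c, (K x = 0 ↔ κ c = 0) := fun c x hx => by
    rw [hK c x hx, mul_eq_zero, or_iff_left (Complex.ofReal_ne_zero.2 (Real.exp_pos _).ne')]
  have hclopen : IsClopen {x | K x = 0} := by
    constructor
    · rw [← isOpen_compl_iff, isOpen_iff_mem_nhds]
      intro x hx
      filter_upwards [(hVo x).mem_nhds (hcV x)] with z hz h0
      exact hx ((hK0 x x (hcV x)).2 ((hK0 x z hz).1 h0))
    · rw [isOpen_iff_mem_nhds]
      intro x hx
      filter_upwards [(hVo x).mem_nhds (hcV x)] with z hz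
      exact (hK0 x z hz).2 ((hK0 x x (hcV x)).1 hx)
  have hKne : ∀ x, K x ≠ 0 := by
    rcases isClopen_iff.1 hclopen with h | h
    · intro x hx
      have : x ∈ {x | K x = 0} := hx
      rw [h] at this
      exact this
    · obtain ⟨f, hf, hf0⟩ := hne
      refine absurd (apply_eq_zero_of_locally hVo hcV (fun c g hg hgs => ?_) hf) hf0
      have : c ∈ {x | K x = 0} := h ▸ Set.mem_univ c
      rw [hκ c g hg hgs, (hK0 c c (hcV c)).1 this, zero_mul]
  have hloc : ∀ c, (fun x => Real.log ‖K x‖ / β) =ᶠ[𝓝 c]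
      fun x => X.localHamiltonian c x + Real.log ‖κ c‖ / β := by
    intro c
    have hκ0 : κ c ≠ 0 := fun h => hKne c ((hK0 c c (hcV c)).2 h)
    filter_upwards [(hVo c).mem_nhds (hcV c)] with x hx
    rw [hK c x hx, norm_mul, Complex.norm_real, Real.norm_of_nonneg (Real.exp_pos _).le,
      Real.log_mul (norm_ne_zero_iff.2 hκ0) (Real.exp_pos _).ne', Real.log_exp]
    field_simp
    ring
  refine ⟨fun x => Real.log ‖K x‖ / β, fun c => ?_, fun c => ?_⟩
  · exact (((hH c).1 c).add contMDiffAt_const).congr_of_eventuallyEq (hloc c)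
  · rw [dForm_congr_add_const (((hH c).1 c).mdifferentiableAt (by simp)) (hloc c)]
    exact (hH c).2.self_of_nhds

end Globalization

end

theorem theorem4p2 {n : ℕ} {M : Type*} [TopologicalSpace M]
    [ChartedSpace (EuclideanSpace ℝ (Fin n)) M] [IsManifold (𝓡 n) ∞ M] [T2Space M]
    [SecondCountableTopology M] [ConnectedSpace M]
    (σ : SymplecticForm n M) (S : StarProduct σ) (X : SymplecticVectorField σ)
    (β : ℝ) (hβ : β ≠ 0)
    (μ : compactFormalFunctions n M →ₗ[PowerSeries ℂ] PowerSeries ℂ)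
    (hμ : IsStaticKMS S X β μ) :
    μ = 0 ∨ IsExactOneForm (interior₂ σ.form X.field) := by
  refine or_iff_not_imp_left.2 fun hne => ?_
  obtain ⟨T, hT0, hT⟩ := exists_classical_KMS S X β μ hμ hne
  exact isExactOneForm_of_classical_KMS X hβ hT0 hT
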